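/- For $g\ge 1$ and a commutative ring $R$ let $\mathsf{Sp}(2g,R)$ be the group of $2g\times 2g$ matrices $X$ over $R$ with $X^tJX=J$, where $J=\begin{pmatrix}0&I\\-I&0\end{pmatrix}$. Let $\mathfrak{K}\le\mathsf{Sp}(2g,\mathbb{Z})$ be the normal subgroup of those matrices of the form $\begin{pmatrix}I+2a&2b\\2c&I+2d\end{pmatrix}$, with $a,b,c,d$ integral $g\times g$ matrices, for which all diagonal entries of $b$ and $c$ are even and $\mathrm{Tr}(a)$ is even. Put $\mathfrak{H}=\mathsf{Sp}(2g,\mathbb{Z})/\mathfrak{K}$. Let $g\ge 3$ and let $A$ be any abelian group, regarded as a coefficient module with trivial action. Then: (1) For every $n\ge 1$, the map $H^2(\mathsf{Sp}(2g,\mathbb{Z}/2^n),A)\to H^2(\mathsf{Sp}(2g,\mathbb{Z}),A)$ induced by reduction modulo $2^n$ is injective. (2) The projection $\mathsf{Sp}(2g,\mathbb{Z})\to\mathfrak{H}$ factors uniquely through reduction modulo $4$, as $\mathsf{Sp}(2g,\mathbb{Z})\to\mathsf{Sp}(2g,\mathbb{Z}/4)\xrightarrow{\,q\,}\mathfrak{H}$,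 and the inflation map $q^*\colon H^2(\mathfrak{H},A)\to H^2(\mathsf{Sp}(2g,\mathbb{Z}/4),A)$ is injective. -/

import Mathlib

open Matrix

universe u

/-- The symplectic group `Sp(2g, R)`, as a group of `2g × 2g` matrices in `g × g` blocks. -/
abbrev Sp (g : ℕ) (R : Type) [CommRing R] : Type :=
  Matrix.symplecticGroup (Fin g) R

/-- The homomorphism `Sp(2g, ℤ) → Sp(2g, ℤ/N)` reducing the entries of a matrix modulo `N`. -/
def Sp.reduction (g N : ℕ) : Sp g ℤ →* Sp g (ZMod N) where
  toFun X := ⟨X.1.map (Int.castRingHom (ZMod N)), SymplecticGroup.map_mem X.2 _⟩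
  map_one' := Subtype.ext (by simp)
  map_mul' X Y := Subtype.ext (Matrix.map_mul (f := Int.castRingHom (ZMod N)))

/-- Membership in the subgroup `𝔎` of `Sp(2g, ℤ)`: the matrix has the block form
`(I + 2a, 2b; 2c, I + 2d)`, where the diagonal entries of `b` and `c` are even and the trace of `a`
is even. -/
def Sp.InK {g : ℕ} (X : Sp g ℤ) : Prop :=
  ∃ a b c d : Matrix (Fin g) (Fin g) ℤ,
    X.1 = fromBlocks (1 + (2 : ℤ) • a) ((2 : ℤ) • b) ((2 : ℤ) • c) (1 + (2 : ℤ) • d) ∧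
    (∀ i, Even (b i i)) ∧ (∀ i, Even (c i i)) ∧ Even a.trace

section helpers

/-- An integral matrix that is symmetric modulo 2 with even diagonal is `U + Uᵀ` modulo 2. -/
theorem exists_alternating_form {g : ℕ} (c K : Matrix (Fin g) (Fin g) ℤ) (h : c - cᵀ = (2 : ℤ) • K)
    (hd : ∀ i, Even (c i i)) : ∃ U E : Matrix (Fin g) (Fin g) ℤ, c = U + Uᵀ + (2 : ℤ) • E := by
  have key : ∀ i j, ∃ e : ℤ, c i j = (if i < j then c i j else 0)
      + (if j < i then c j i else 0) + 2 * e := by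
    intro i j
    rcases lt_trichotomy i j with hij | hij | hij
    · exact ⟨0, by simp [hij, hij.not_gt]⟩
    · subst hij
      obtain ⟨r, hr⟩ := hd i
      exact ⟨r, by simp [hr]; ring⟩
    · refine ⟨K i j, ?_⟩
      have := congrFun (congrFun h i) j
      simp at this
      simp [hij, hij.not_gt]
      linarith
  choose e he using key
  refine ⟨of fun i j => if i < j then c i j else 0, of e, ?_⟩
  ext i j
  simpa using he i j

/-- A description of membership in `𝔎` that is convenient for checking the group axioms. -/
theorem Sp.inK_iff {g : ℕ} (X : Sp g ℤ) : X.InK ↔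
    ∃ L E : Matrix (Fin g ⊕ Fin g) (Fin g ⊕ Fin g) ℤ,
      X.1 = 1 + (2 : ℤ) • (J (Fin g) ℤ * (L + Lᵀ)) + (4 : ℤ) • E ∧ Even (J (Fin g) ℤ * L).trace := by
  constructor
  · rintro ⟨a, b, c, d, hX, hb, hc, ha⟩
    have hm := X.2
    rw [hX, SymplecticGroup.fromBlocks_mem_iff] at hm
    obtain ⟨h1, h2, h3⟩ := hm
    obtain ⟨U, E, hU⟩ := exists_alternating_form c (cᵀ * a - aᵀ * c) (by
      ext i j
      have := congrFun (congrFun h1 i) j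
      simp [-zsmul_eq_mul, add_mul, mul_add] at this ⊢
      linarith) hc
    obtain ⟨V, F, hV⟩ := exists_alternating_form b (bᵀ * d - dᵀ * b) (by
      ext i j
      have := congrFun (congrFun h2 i) j
      simp [-zsmul_eq_mul, add_mul, mul_add] at this ⊢
      linarith) hb
    have h4 : a + dᵀ = (2 : ℤ) • (bᵀ * c - dᵀ * a) := by
      have h3' := congrArg Matrix.transpose h3
      rw [transpose_sub, transpose_mul, transpose_mul, transpose_one] at h3'
      ext i j
      have := congrFun (congrFun h3' i) j
      simp [-zsmul_eq_mul, add_mul, mul_add] at this ⊢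
      linarith
    refine ⟨fromBlocks U d 0 (-V), fromBlocks (bᵀ * c - dᵀ * a) F E 0, ?_, ?_⟩
    · rw [hX, J, ← fromBlocks_one, fromBlocks_transpose, fromBlocks_add, fromBlocks_multiply,
        fromBlocks_smul, fromBlocks_smul, fromBlocks_add, fromBlocks_add]
      congr 1
      · have : a = (2 : ℤ) • (bᵀ * c - dᵀ * a) - dᵀ := by rw [← h4]; abel
        generalize bᵀ * c - dᵀ * a = W at this ⊢
        subst this
        ext i j
        simp [-zsmul_eq_mul]
        ring
      · conv_lhs => rw [hV]
        ext i j
        simp [-zsmul_eq_mul]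
        ring
      · conv_lhs => rw [hU]
        ext i j
        simp [-zsmul_eq_mul]
        ring
      · simp [-zsmul_eq_mul]
    · have := congrArg Matrix.trace h4
      simp [-zsmul_eq_mul, trace_add, trace_transpose] at this
      obtain ⟨r, hr⟩ := ha
      simp [-zsmul_eq_mul, J, fromBlocks_multiply, Matrix.trace, Fintype.sum_sum_type]
      have e : ∑ x, d x x = d.trace := rfl
      rw [e]
      exact ⟨(bᵀ * c).trace - (dᵀ * a).trace - r, by linarith⟩
  · rintro ⟨L, E, hX, hL⟩
    obtain ⟨p, q, r, s, rfl⟩ : ∃ p q r s, L = fromBlocks p q r s :=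
      ⟨_, _, _, _, (fromBlocks_toBlocks L).symm⟩
    obtain ⟨e, f, h, k, rfl⟩ : ∃ p q r s, E = fromBlocks p q r s :=
      ⟨_, _, _, _, (fromBlocks_toBlocks E).symm⟩
    refine ⟨-(r + qᵀ) + (2 : ℤ) • e, -(s + sᵀ) + (2 : ℤ) • f, p + pᵀ + (2 : ℤ) • h,
      q + rᵀ + (2 : ℤ) • k, ?_, ?_, ?_, ?_⟩
    · rw [hX, J, ← fromBlocks_one, fromBlocks_transpose, fromBlocks_add, fromBlocks_multiply,
        fromBlocks_smul, fromBlocks_smul, fromBlocks_add, fromBlocks_add]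
      congr 1 <;> (ext i j; simp [-zsmul_eq_mul]; ring)
    · exact fun i => ⟨-s i i + f i i, by simp [-zsmul_eq_mul]; ring⟩
    · exact fun i => ⟨p i i + h i i, by simp [-zsmul_eq_mul]; ring⟩
    · obtain ⟨t, ht⟩ := hL
      simp [-zsmul_eq_mul, J, fromBlocks_multiply, Matrix.trace, Fintype.sum_sum_type] at ht
      have e1 : ∑ x, q x x = q.trace := rfl
      have e2 : ∑ x, r x x = r.trace := rfl
      rw [e1, e2] at ht
      exact ⟨e.trace - r.trace - t, by simp [-zsmul_eq_mul]; linarith⟩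

end helpers

/-- The subgroup `𝔎` of `Sp(2g, ℤ)`. -/
def Sp.frakK (g : ℕ) : Subgroup (Sp g ℤ) where
  carrier := {X | X.InK}
  one_mem' := ⟨0, 0, 0, 0, by simp, by simp, by simp, by simp⟩
  mul_mem' {X Y} hX hY := by
    obtain ⟨L, E, hX, hL⟩ := (Sp.inK_iff X).1 hX
    obtain ⟨L', E', hY, hL'⟩ := (Sp.inK_iff Y).1 hY
    refine (Sp.inK_iff _).2 ⟨L + L', E + E' +
      (J (Fin g) ℤ * (L + Lᵀ)) * (J (Fin g) ℤ * (L' + L'ᵀ)) +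
      (2 : ℤ) • (J (Fin g) ℤ * (L + Lᵀ) * E') + (2 : ℤ) • (E * (J (Fin g) ℤ * (L' + L'ᵀ))) + (4 : ℤ) • (E * E'),
      ?_, ?_⟩
    · rw [Submonoid.coe_mul, hX, hY, transpose_add]
      noncomm_ring
    · rw [mul_add, trace_add]
      exact hL.add hL'
  inv_mem' {X} hX := by
    obtain ⟨L, E, hX, hL⟩ := (Sp.inK_iff X).1 hX
    refine (Sp.inK_iff _).2 ⟨-L, -(J (Fin g) ℤ * Eᵀ * J (Fin g) ℤ), ?_, ?_⟩
    · have hJ := J_squared (Fin g) ℤ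
      have e : J (Fin g) ℤ * ((L + Lᵀ) * J (Fin g) ℤ) * J (Fin g) ℤ
          = - (J (Fin g) ℤ * (L + Lᵀ)) := by
        rw [mul_assoc, mul_assoc, hJ]; noncomm_ring
      have e2 : (1 + (2 : ℤ) • (J (Fin g) ℤ * (L + Lᵀ)) + (4 : ℤ) • E)ᵀ
          = 1 - (2 : ℤ) • ((L + Lᵀ) * J (Fin g) ℤ) + (4 : ℤ) • Eᵀ := by
        simp only [transpose_add, transpose_smul, transpose_mul, transpose_one, J_transpose,
          transpose_transpose]
        noncomm_ring
      rw [SymplecticGroup.coe_inv, hX, e2]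
      calc _ = -(J (Fin g) ℤ * J (Fin g) ℤ)
              + (2 : ℤ) • (J (Fin g) ℤ * ((L + Lᵀ) * J (Fin g) ℤ) * J (Fin g) ℤ)
              - (4 : ℤ) • (J (Fin g) ℤ * Eᵀ * J (Fin g) ℤ) := by noncomm_ring
        _ = _ := by
          rw [e, hJ, transpose_neg]
          noncomm_ring
    · simpa using hL

instance Sp.frakK_normal (g : ℕ) : (Sp.frakK g).Normal where
  conj_mem X hX P := by
    obtain ⟨L, E, hX, hL⟩ := (Sp.inK_iff X).1 hX
    have h1 : P.1 * (P⁻¹).1 = 1 := congrArg Subtype.val (mul_inv_cancel P)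
    have hQ := SymplecticGroup.mem_iff.1 (P⁻¹).2
    have h2 : P.1 * J (Fin g) ℤ = J (Fin g) ℤ * (P⁻¹).1ᵀ := by
      conv_lhs => rw [← hQ]
      rw [← mul_assoc, ← mul_assoc, h1, one_mul]
    refine (Sp.inK_iff _).2 ⟨(P⁻¹).1ᵀ * L * (P⁻¹).1, P.1 * E * (P⁻¹).1, ?_, ?_⟩
    · rw [Submonoid.coe_mul, Submonoid.coe_mul, hX]
      calc _ = P.1 * (P⁻¹).1 + (2 : ℤ) • ((P.1 * J (Fin g) ℤ) * (L + Lᵀ) * (P⁻¹).1)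
              + (4 : ℤ) • (P.1 * E * (P⁻¹).1) := by noncomm_ring
        _ = _ := by
          rw [h1, h2]
          simp only [transpose_mul, transpose_transpose]
          noncomm_ring
    · have : (J (Fin g) ℤ * ((P⁻¹).1ᵀ * L * (P⁻¹).1)).trace = (J (Fin g) ℤ * L).trace := by
        rw [← mul_assoc, trace_mul_comm, ← mul_assoc, ← mul_assoc, hQ]
      rw [this]
      exact hL

/-- The group `𝔥 = Sp(2g, ℤ) / 𝔎`. -/
abbrev Sp.frakH (g : ℕ) : Type := Sp g ℤ ⧸ Sp.frakK g

/-- The cohomology group `H²(G, A)` with coefficients in the abelian group `A` with trivial action.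
The liftings only serve to allow an abelian group `A` in an arbitrary universe. -/
noncomputable abbrev trivialH2 (G : Type) [Group G] (A : Type u) [AddCommGroup A] :
    ModuleCat.{u} (ULift.{u} ℤ) :=
  groupCohomology (Rep.trivial (ULift.{u} ℤ) (ULift.{u} G) A) 2

/-- The map `f^* : H²(H, A) → H²(G, A)` induced by a homomorphism `f : G → H`, for coefficients in
the abelian group `A` with trivial action. On cocycles it is composition with `f`. -/
noncomputable def trivialH2Map {G H : Type} [Group G] [Group H] (f : G →* H)
    (A : Type u) [AddCommGroup A] : trivialH2 H A ⟶ trivialH2 G A :=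
  groupCohomology.map
    (A := Rep.trivial (ULift.{u} ℤ) (ULift.{u} H) A)
    (B := Rep.trivial (ULift.{u} ℤ) (ULift.{u} G) A)
    ((MulEquiv.ulift.symm.toMonoidHom.comp f).comp MulEquiv.ulift.toMonoidHom)
    (CategoryTheory.CategoryStruct.id (Rep.trivial (ULift.{u} ℤ) (ULift.{u} G) A)) 2

/-! For a surjection `G → H` with kernel `K`, the five-term exact sequence identifies the kernel of
inflation on `H²` with a quotient of the `G`-invariant homomorphisms `K → A`. These factor through
`K / [K, G]`, so inflation is injective for every trivial `A` once `K ≤ [K, G]`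
(`trivialH2Map_injective`). Both assertions thus become statements about two kernels.

For reduction modulo `2 ^ n` the kernel is the principal congruence subgroup. The quotient map `φ`
by its commutator with `Sp(2g, ℤ)` is central on it, and the task is to show that `φ` kills it.
Column reduction (`Sp.cong_le`) generates the congruence subgroup by elementary matrices of level `2
^ n` and by level-`2 ^ n` matrices in the `SL₂` of a single hyperbolic plane. For `g ≥ 3` commutator
relations kill the elementary matrices. On an `SL₂` the value of `φ` then depends only on the first
row, a Mennicke symbol in the style of Bass, Milnor and Serre.

For an `SL₂` inside the Levi subgroup `SL₃` the symbol is multiplicative in both entries, and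
Dirichlet's theorem provides primes for which its order divides two coprime numbers
(`mennicke_symbol_eq_one`). For the `SL₂` of a hyperbolic plane only invariance under `b ↦ b * e ^
2` is proved (`Sp.map_long_sq`). This is enough: modulo a prime `l ≡ -1` mod `4` every unit is plus
or minus a square, so the symbol reduces to one with second entry `± 2 ^ n`, which is trivial.

For `q` the kernel is the image of `𝔎` in `Sp(2g, ℤ/4)`. It consists of the elements `1 + 2 J (L +
Lᵀ)` with a parity condition on the trace, and multiplies as the matrices `L` add. Conjugation acts
by `L ↦ Xᵀ L X`, and the differences `Xᵀ L X - L` account for the whole kernel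
(`Sp.symElem_mem_commutator`). Existence and uniqueness of `q` follow from surjectivity of reduction
modulo `4` and the fact that its kernel lies in `𝔎`. -/

open scoped commutatorElement MatrixGroups

/-! ### Inflation in degree two. -/

/-- If the kernel of a surjection `f : G → H` is generated by its commutators with `G`, then a
2-cocycle on `H` with trivial coefficients is a coboundary as soon as its inflation to `G` is. -/
theorem exists_cobounding_of_inflation {G H A : Type*} [Group G] [Group H] [AddCommGroup A]
    (f : G →* H) (hf : Function.Surjective f) (hK : f.ker ≤ ⁅f.ker, (⊤ : Subgroup G)⁆)
    (σ : H → H → A) (hl : ∀ h, σ 1 h = σ 1 1) (hr : ∀ h, σ h 1 = σ 1 1) (τ : G → A)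
    (hτ : ∀ x y, τ y - τ (x * y) + τ x = σ (f x) (f y)) :
    ∃ τ' : H → A, ∀ x y, τ' y - τ' (x * y) + τ' x = σ x y := by
  have h1 : τ 1 = σ 1 1 := by simpa using hτ 1 1
  have hkl : ∀ k ∈ f.ker, ∀ x, τ (k * x) = τ k + τ x - σ 1 1 := by
    intro k hk x
    have := hτ k x
    rw [MonoidHom.mem_ker.1 hk, hl] at this
    rw [← this]; abel
  have hkr : ∀ k ∈ f.ker, ∀ x, τ (x * k) = τ k + τ x - σ 1 1 := by
    intro k hk x
    have := hτ x k
    rw [MonoidHom.mem_ker.1 hk, hr] at this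
    rw [← this]; abel
  -- On the kernel `τ - σ 1 1` is a homomorphism, and `S` is the subgroup on which it vanishes.
  let S : Subgroup G :=
    { carrier := {k | k ∈ f.ker ∧ τ k = σ 1 1}
      one_mem' := ⟨one_mem _, h1⟩
      mul_mem' := fun {a b} ha hb => ⟨mul_mem ha.1 hb.1, by rw [hkl a ha.1, ha.2, hb.2]; abel⟩
      inv_mem' := fun {a} ha => ⟨inv_mem ha.1, by
        have := hkl a ha.1 a⁻¹
        rw [mul_inv_cancel, h1, ha.2] at this
        simpa using this.symm⟩ }
  have hS : ∀ k ∈ f.ker, τ k = σ 1 1 := by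
    have : ⁅f.ker, (⊤ : Subgroup G)⁆ ≤ S := by
      rw [Subgroup.commutator_le]
      intro k hk x _
      have hm : ⁅k, x⁆ ∈ f.ker := by
        rw [MonoidHom.mem_ker] at hk ⊢
        simp [commutatorElement_def, hk]
      refine ⟨hm, ?_⟩
      have h := hkl _ hm (x * k)
      have e : ⁅k, x⁆ * (x * k) = k * x := by simp [commutatorElement_def, mul_assoc]
      rw [e, hkl k hk, hkr k hk] at h
      generalize τ k + τ x - σ 1 1 = w at h
      rw [add_sub_right_comm, right_eq_add] at h
      exact sub_eq_zero.1 h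
    exact fun k hk => (this (hK hk)).2
  -- Being constant on the kernel, `τ` is constant on the fibres of `f` and descends to `H`.
  have hfac : ∀ x y, f x = f y → τ x = τ y := by
    intro x y hxy
    have hk : x * y⁻¹ ∈ f.ker := by rw [MonoidHom.mem_ker, map_mul, map_inv, hxy, mul_inv_cancel]
    have := hkl _ hk y
    rw [inv_mul_cancel_right, hS _ hk] at this
    simpa using this
  choose s hs using hf
  refine ⟨fun h => τ (s h), fun x y => ?_⟩
  change τ (s y) - τ (s (x * y)) + τ (s x) = _
  rw [hfac (s (x * y)) (s x * s y) (by rw [map_mul, hs, hs, hs]), hτ, hs, hs]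

/-- Injectivity of inflation on `H²` with trivial coefficients. -/
theorem trivialH2Map_injective {G H : Type} [Group G] [Group H] (f : G →* H)
    (hf : Function.Surjective f) (hK : f.ker ≤ ⁅f.ker, (⊤ : Subgroup G)⁆)
    (A : Type u) [AddCommGroup A] : Function.Injective (trivialH2Map f A) := by
  rw [injective_iff_map_eq_zero]
  intro a
  induction a using groupCohomology.H2_induction_on with
  | h σ =>
    intro h
    have h' := groupCohomology.H2π_comp_map_apply
      (A := Rep.trivial (ULift.{u} ℤ) (ULift.{u} H) A)
      (B := Rep.trivial (ULift.{u} ℤ) (ULift.{u} G) A)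
      ((MulEquiv.ulift.symm.toMonoidHom.comp f).comp MulEquiv.ulift.toMonoidHom)
      (CategoryTheory.CategoryStruct.id (Rep.trivial (ULift.{u} ℤ) (ULift.{u} G) A)) σ
    have h2 := (h'.symm.trans h)
    rw [groupCohomology.H2π_eq_zero_iff] at h2 ⊢
    obtain ⟨τ, hτ⟩ := h2
    obtain ⟨τ', hτ'⟩ := exists_cobounding_of_inflation f hf hK
      (fun x y => σ (ULift.up x, ULift.up y))
      (fun x => groupCohomology.cocycles₂_map_one_fst σ _)
      (fun x => groupCohomology.cocycles₂_map_one_snd σ (ULift.up x))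
      (fun x => τ (ULift.up x)) (fun x y => congrFun hτ (ULift.up x, ULift.up y))
    exact ⟨fun x => τ' x.down, funext fun p => hτ' p.1.down p.2.down⟩

/-! ### Primes in progressions and the vanishing of Mennicke symbols. -/

/-- A common strengthening of Dirichlet's theorem: a prime in a progression modulo a product of two
coprime integers. -/
theorem exists_prime_modEq_and_modEq {m k r s : ℤ} (hm : m ≠ 0) (hk : k ≠ 0) (hmk : IsCoprime m k)
    (hr : IsCoprime r m) (hs : IsCoprime s k) :
    ∃ p : ℕ, 2 < p ∧ p.Prime ∧ (p : ℤ) ≡ r [ZMOD m] ∧ (p : ℤ) ≡ s [ZMOD k] := by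
  obtain ⟨u, v, huv⟩ := hmk
  set t := r * (v * k) + s * (u * m) with ht
  have htm : t ≡ r [ZMOD m] := by
    rw [Int.modEq_iff_dvd]; exact ⟨(r - s) * u, by rw [ht]; linear_combination -r * huv⟩
  have htk : t ≡ s [ZMOD k] := by
    rw [Int.modEq_iff_dvd]; exact ⟨(s - r) * v, by rw [ht]; linear_combination -s * huv⟩
  have hco : IsCoprime t ((m * k).natAbs : ℤ) := by
    rw [Int.natCast_natAbs, IsCoprime.abs_right_iff]
    refine IsCoprime.mul_right ?_ ?_
    · obtain ⟨c, hc⟩ := Int.modEq_iff_dvd.1 htm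
      rw [show t = r + m * (-c) by linarith]
      exact hr.add_mul_left_left _
    · obtain ⟨c, hc⟩ := Int.modEq_iff_dvd.1 htk
      rw [show t = s + k * (-c) by linarith]
      exact hs.add_mul_left_left _
  obtain ⟨p, hp, hpp, hpt⟩ := Nat.forall_exists_prime_gt_and_zmodEq 2
    (Int.natAbs_ne_zero.2 (mul_ne_zero hm hk)) hco
  have hpt' : (p : ℤ) ≡ t [ZMOD (m * k)] := by
    rw [Int.natCast_natAbs, Int.modEq_iff_dvd, abs_dvd] at hpt
    rwa [Int.modEq_iff_dvd]
  exact ⟨p, hp, hpp, (hpt'.of_mul_right _).trans htm, (hpt'.of_mul_left _).trans htk⟩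

theorem IsCoprime.of_modEq {x y a : ℤ} (h : IsCoprime x a) (hxy : x ≡ y [ZMOD a]) :
    IsCoprime y a := by
  obtain ⟨c, hc⟩ := Int.modEq_iff_dvd.1 hxy
  rw [show y = x + a * c by linarith]
  exact h.add_mul_left_left _

/-- Replacing the arguments of a Mennicke symbol of level `2 ^ n` by an odd integer and a negative
prime. -/
theorem exists_odd_and_neg_prime {n : ℕ} (hn : 1 ≤ n) {x a : ℤ} (ha : a ≡ 1 [ZMOD 2 ^ n])
    (hxa : IsCoprime x a) :
    ∃ (y : ℤ) (l : ℕ), y ≠ 0 ∧ x ≡ y [ZMOD a] ∧ l.Prime ∧ 2 < l ∧ IsCoprime y a ∧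
      a ≡ -l [ZMOD 2 ^ n * y] ∧ -(l : ℤ) ≡ 1 [ZMOD 2 ^ n] ∧ (l : ℤ) ≡ -1 [ZMOD 4] ∧
      IsCoprime y l := by
  have ha2 : a % 2 = 1 := by
    have h2 : (2 : ℤ) ∣ 2 ^ n := dvd_pow_self 2 (by omega)
    have := ha.of_dvd h2
    rw [Int.ModEq] at this
    omega
  obtain ⟨y, hy, hxy⟩ : ∃ y : ℤ, y % 2 = 1 ∧ x ≡ y [ZMOD a] := by
    rcases Int.emod_two_eq_zero_or_one x with h | h
    · exact ⟨x + a, by omega, by simp [Int.modEq_iff_dvd]⟩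
    · exact ⟨x, h, rfl⟩
  have hya : IsCoprime y a := hxa.of_modEq hxy
  have hy2 : IsCoprime y (2 ^ (n + 2)) := by
    apply IsCoprime.pow_right
    exact Int.isCoprime_iff_gcd_eq_one.2 (by
      rw [Int.gcd_comm, ← Int.isCoprime_iff_gcd_eq_one, Int.prime_two.coprime_iff_not_dvd]; omega)
  have hy0 : y ≠ 0 := by rintro rfl; omega
  -- The exponent `n + 2` yields at once `-l ≡ 1` modulo `2 ^ n` and `l ≡ -1` modulo `4`, whatever
  -- `n` is.
  obtain ⟨l, hl, hlp, hl1, hl2⟩ := exists_prime_modEq_and_modEq hy0 (by positivity) hy2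
    (r := -a) (s := -1) hya.symm.neg_left isCoprime_one_left.neg_left
  have h4 : (l : ℤ) ≡ -1 [ZMOD 4] := hl2.of_dvd ⟨2 ^ n, by rw [pow_add]; ring⟩
  have h2n : (l : ℤ) ≡ -1 [ZMOD 2 ^ n] := hl2.of_dvd ⟨4, by rw [pow_add]; ring⟩
  have h3 : -(l : ℤ) ≡ 1 [ZMOD 2 ^ n] := by simpa using h2n.neg
  have h5 : a ≡ -l [ZMOD y] := by simpa using hl1.symm.neg
  refine ⟨y, l, hy0, hxy, hlp, hl, hya, ?_, h3, h4, ?_⟩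
  · rw [Int.modEq_iff_dvd]
    refine IsCoprime.mul_dvd (hy2.symm.of_isCoprime_of_dvd_left ⟨4, by rw [pow_add]; ring⟩) ?_ ?_
    · exact Int.modEq_iff_dvd.1 (ha.trans h3.symm)
    · exact Int.modEq_iff_dvd.1 h5
  · have := (hya.symm.of_modEq h5).symm
    exact (IsCoprime.neg_right_iff _ _).1 this

/-- Triviality of Mennicke symbols of level `2 ^ n`. Here `s x a` stands for the symbol with
entries `2 ^ n * x` and `a`. -/
theorem mennicke_symbol_eq_one {Q : Type*} [Group Q] {n : ℕ} (hn : 1 ≤ n) (s : ℤ → ℤ → Q)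
    (h1 : ∀ a, a ≡ 1 [ZMOD 2 ^ n] → s 1 a = 1) (hneg : ∀ a, a ≡ 1 [ZMOD 2 ^ n] → s (-1) a = 1)
    (ha1 : ∀ x, s x 1 = 1)
    (hx : ∀ x y a, a ≡ 1 [ZMOD 2 ^ n] → IsCoprime x a → x ≡ y [ZMOD a] → s x a = s y a)
    (ha : ∀ x a b, a ≡ 1 [ZMOD 2 ^ n] → IsCoprime x a → a ≡ b [ZMOD 2 ^ n * x] → s x a = s x b)
    (hmx : ∀ x y a, a ≡ 1 [ZMOD 2 ^ n] → IsCoprime x a → IsCoprime y a →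
      s (x * y) a = s x a * s y a)
    (hma : ∀ x a b, a ≡ 1 [ZMOD 2 ^ n] → b ≡ 1 [ZMOD 2 ^ n] → IsCoprime x a → IsCoprime x b →
      s x (a * b) = s x a * s x b)
    (x a : ℤ) (haL : a ≡ 1 [ZMOD 2 ^ n]) (hxa : IsCoprime x a) : s x a = 1 := by
  obtain ⟨y, l, hy0, hxy, hlp, hl2, hya, hal, hlL, hl4, hyl⟩ := exists_odd_and_neg_prime hn haL hxa
  rw [hx x y a haL hxa hxy, ha y a _ haL hya hal]
  have hfact : Fact l.Prime := ⟨hlp⟩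
  have hlodd : ∃ k : ℤ, (l : ℤ) = 4 * k + 3 := by
    obtain ⟨c, hc⟩ := Int.modEq_iff_dvd.1 hl4
    exact ⟨-c - 1, by linarith⟩
  obtain ⟨k, hk⟩ := hlodd
  -- The condition modulo `l` lets `p` replace `y` in the symbol. The condition modulo `(l - 1) / 2`
  -- gives `p - 1 ≡ -2` there, and this modulus is odd, so it is coprime to `p - 1`.
  obtain ⟨p, hp2, hpp, hpy, hpl⟩ := exists_prime_modEq_and_modEq (m := l) (k := (l / 2 : ℕ))
    (r := y) (s := -1) (by exact_mod_cast hlp.ne_zero) (by norm_cast; omega)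
    (by
      have : (l : ℤ) = 1 + ((l / 2 : ℕ) : ℤ) * 2 := by omega
      rw [this]
      exact isCoprime_one_left.add_mul_left_left 2)
    hyl isCoprime_one_left.neg_left
  have hpl' : IsCoprime (p : ℤ) (-l) := (hyl.of_modEq hpy.symm).neg_right
  have hyp : y ≡ p [ZMOD -l] := by simpa [Int.modEq_neg] using hpy.symm
  rw [hx y p _ hlL hyl.neg_right hyp]
  have powx : ∀ j : ℕ, s (p ^ j) (-l) = s p (-l) ^ j := by
    intro j
    induction j with
    | zero => simpa using h1 _ hlL
    | succ j ih => rw [pow_succ, pow_succ, hmx _ _ _ hlL hpl'.pow_left hpl', ih]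
  have powa : ∀ j : ℕ, s p ((-l) ^ j) = s p (-l) ^ j := by
    intro j
    induction j with
    | zero => simpa using ha1 _
    | succ j ih =>
      rw [pow_succ, pow_succ, hma _ _ _ (by simpa using hlL.pow j) hlL hpl'.pow_right hpl', ih]
  -- By Euler's criterion `p ^ ((l - 1) / 2)` is `± 1` modulo `l`, and both of these symbols are
  -- trivial.
  have e1 : s p (-l) ^ (l / 2) = 1 := by
    rw [← powx]
    have hp0 : (p : ZMod l) ≠ 0 := by
      have := hyl.of_modEq hpy.symm
      rw [Nat.isCoprime_iff_coprime] at this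
      exact ((ZMod.isUnit_iff_coprime p l).2 this).ne_zero
    have hco : IsCoprime ((p : ℤ) ^ (l / 2)) (-l) := hpl'.pow_left
    rcases ZMod.pow_div_two_eq_neg_one_or_one l hp0 with h | h
    · rw [hx _ 1 _ hlL hco, h1 _ hlL]
      rw [Int.modEq_neg, ← ZMod.intCast_eq_intCast_iff]
      exact_mod_cast h
    · rw [hx _ (-1) _ hlL hco, hneg _ hlL]
      rw [Int.modEq_neg, ← ZMod.intCast_eq_intCast_iff]
      push_cast
      exact_mod_cast h
  have hfp : Fact p.Prime := ⟨hpp⟩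
  -- Fermat's little theorem modulo `p`, together with `-l ≡ 1` modulo `2 ^ n`, replaces `(-l) ^ (p
  -- - 1)` by `1`.
  have e2 : s p (-l) ^ (p - 1) = 1 := by
    rw [← powa, ha p _ 1 (by simpa using hlL.pow (p - 1)) hpl'.pow_right, ha1]
    rw [Int.modEq_iff_dvd]
    refine IsCoprime.mul_dvd ?_ ?_ ?_
    · apply IsCoprime.pow_left
      rw [Int.prime_two.coprime_iff_not_dvd]
      rintro ⟨c, hc⟩
      have : 2 ∣ p := by omega
      have := (Nat.prime_dvd_prime_iff_eq Nat.prime_two hpp).1 this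
      omega
    · exact Int.modEq_iff_dvd.1 (by simpa using hlL.pow (p - 1))
    · rw [← ZMod.intCast_eq_intCast_iff_dvd_sub]
      push_cast
      refine ZMod.pow_card_sub_one_eq_one ?_
      intro h0
      have h3 : IsUnit ((-(l : ℤ) : ℤ) : ZMod p) := (ZMod.coe_int_isUnit_iff_isCoprime _ _).2 hpl'
      push_cast at h3
      exact h3.ne_zero h0
  have hcop : Nat.Coprime (l / 2) (p - 1) := by
    rw [← Nat.isCoprime_iff_coprime]
    obtain ⟨c, hc⟩ := Int.modEq_iff_dvd.1 hpl
    rw [Nat.cast_sub (by omega), Nat.cast_one,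
      show (p : ℤ) - 1 = -2 + ((l / 2 : ℕ) : ℤ) * (-c) by linarith]
    apply IsCoprime.add_mul_left_right
    have : ((l / 2 : ℕ) : ℤ) = 2 * k + 1 := by omega
    rw [this]
    exact ⟨1, k, by ring⟩
  have := orderOf_dvd_of_pow_eq_one e1
  have h2 := orderOf_dvd_of_pow_eq_one e2
  have h3 := Nat.dvd_gcd this h2
  rw [hcop.gcd_eq_one, Nat.dvd_one, orderOf_eq_one_iff] at h3
  exact h3

/-- If `l` is a prime congruent to `-1` modulo `4` and `u` is prime to `l`, then every integer is
plus or minus the square of a multiple of `u` modulo `l`. -/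
theorem exists_modEq_sq_or_neg_sq {l : ℕ} (hl : l.Prime) (hl4 : (l : ℤ) ≡ -1 [ZMOD 4]) {u y : ℤ}
    (hu : IsCoprime u l) (hy : IsCoprime y l) :
    ∃ w : ℤ, IsCoprime w l ∧ (y ≡ (u * w) ^ 2 [ZMOD l] ∨ y ≡ -(u * w) ^ 2 [ZMOD l]) := by
  have hfact : Fact l.Prime := ⟨hl⟩
  have hu' : (u : ZMod l) ≠ 0 := ((ZMod.coe_int_isUnit_iff_isCoprime u l).2 hu.symm).ne_zero
  have hy' : (y : ZMod l) ≠ 0 := ((ZMod.coe_int_isUnit_iff_isCoprime y l).2 hy.symm).ne_zero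
  have key : ∀ z : ZMod l, z ≠ 0 → IsSquare z → ∃ w : ℤ, IsCoprime w l ∧ z = ((u * w) ^ 2 : ℤ) := by
    rintro z hz ⟨r, rfl⟩
    have hr : r ≠ 0 := by rintro rfl; simp at hz
    obtain ⟨w, hw⟩ := ZMod.intCast_surjective ((u : ZMod l)⁻¹ * r)
    refine ⟨w, IsCoprime.symm ((ZMod.coe_int_isUnit_iff_isCoprime w l).1 ?_), ?_⟩
    · rw [hw]; exact (mul_ne_zero (inv_ne_zero hu') hr).isUnit
    · push_cast
      rw [hw]
      field_simp
  have hsq : IsSquare (y : ZMod l) ∨ IsSquare (-y : ZMod l) := by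
    rw [ZMod.euler_criterion l hy', ZMod.euler_criterion l (neg_ne_zero.2 hy')]
    rcases ZMod.pow_div_two_eq_neg_one_or_one l hy' with h | h
    · exact Or.inl h
    · right
      -- Since `l ≡ 3` modulo `4`, `-1` is a nonresidue, so one of `y` and `-y` is a square.
      have hodd : Odd (l / 2) := by
        obtain ⟨c, hc⟩ := Int.modEq_iff_dvd.1 hl4
        rw [Nat.odd_iff]; omega
      rw [hodd.neg_pow, h, neg_neg]
  rcases hsq with h | h
  · obtain ⟨w, hw, e⟩ := key _ hy' h
    exact ⟨w, hw, Or.inl ((ZMod.intCast_eq_intCast_iff _ _ _).1 e)⟩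
  · obtain ⟨w, hw, e⟩ := key _ (neg_ne_zero.2 hy') h
    refine ⟨w, hw, Or.inr ((ZMod.intCast_eq_intCast_iff _ _ _).1 ?_)⟩
    push_cast at e ⊢
    rw [← e, neg_neg]

/-! ### Homomorphisms central on a subgroup, and first-row symbols on `SL₂`. -/

/-- A homomorphism is central on a subgroup if its values there are unchanged by conjugation. -/
def CentralOn {G Q : Type*} [Group G] [Group Q] (φ : G →* Q) (Γ : Subgroup G) : Prop :=
  ∀ γ ∈ Γ, ∀ x, φ (x * γ * x⁻¹) = φ γ

theorem CentralOn.map_mul_comm {G Q : Type*} [Group G] [Group Q] {φ : G →* Q} {Γ : Subgroup G}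
    (h : CentralOn φ Γ) {γ : G} (hγ : γ ∈ Γ) (x : G) : φ x * φ γ = φ γ * φ x := by
  conv_rhs => rw [← h γ hγ x, ← map_mul]
  rw [← map_mul, inv_mul_cancel_right]

theorem CentralOn.comp {G G' Q : Type*} [Group G] [Group G'] [Group Q] {φ : G →* Q}
    {Γ : Subgroup G} (h : CentralOn φ Γ) (j : G' →* G) {Γ' : Subgroup G'}
    (hj : ∀ γ ∈ Γ', j γ ∈ Γ) : CentralOn (φ.comp j) Γ' := by
  intro γ hγ x
  simpa using h (j γ) (hj γ hγ) (j x)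

namespace SymbolSL2

/-- A matrix of determinant one, given by its entries. -/
def mk (a b c d : ℤ) (h : a * d - b * c = 1) : SL(2, ℤ) := ⟨!![a, b; c, d], by rw [det_fin_two_of, h]⟩

@[simp] theorem coe_mk (a b c d : ℤ) (h : a * d - b * c = 1) :
    (mk a b c d h : Matrix (Fin 2) (Fin 2) ℤ) = !![a, b; c, d] := rfl

/-- Upper triangular elementary matrices. -/
def upper (t : ℤ) : SL(2, ℤ) := mk 1 t 0 1 (by ring)

/-- Lower triangular elementary matrices. -/
def lower (t : ℤ) : SL(2, ℤ) := mk 1 0 t 1 (by ring)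

@[simp] theorem coe_upper (t : ℤ) : (upper t : Matrix (Fin 2) (Fin 2) ℤ) = !![1, t; 0, 1] := rfl

@[simp] theorem coe_lower (t : ℤ) : (lower t : Matrix (Fin 2) (Fin 2) ℤ) = !![1, 0; t, 1] := rfl

theorem det_eq (M : SL(2, ℤ)) : M 0 0 * M 1 1 - M 0 1 * M 1 0 = 1 := by
  rw [← det_fin_two]; exact M.2

theorem mem_Gamma_iff {N : ℕ} {M : SL(2, ℤ)} : M ∈ CongruenceSubgroup.Gamma N ↔
    (N : ℤ) ∣ M 0 0 - 1 ∧ (N : ℤ) ∣ M 0 1 ∧ (N : ℤ) ∣ M 1 0 ∧ (N : ℤ) ∣ M 1 1 - 1 := by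
  rw [CongruenceSubgroup.Gamma_mem]
  simp only [← ZMod.intCast_zmod_eq_zero_iff_dvd, Int.cast_sub, Int.cast_one, sub_eq_zero]

theorem mk_mem_Gamma_iff {N : ℕ} {a b c d : ℤ} {h : a * d - b * c = 1} :
    mk a b c d h ∈ CongruenceSubgroup.Gamma N ↔
      (N : ℤ) ∣ a - 1 ∧ (N : ℤ) ∣ b ∧ (N : ℤ) ∣ c ∧ (N : ℤ) ∣ d - 1 := mem_Gamma_iff

theorem upper_mem {N : ℕ} {t : ℤ} (h : (N : ℤ) ∣ t) : upper t ∈ CongruenceSubgroup.Gamma N := by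
  rw [mem_Gamma_iff]; simp [h]

theorem lower_mem {N : ℕ} {t : ℤ} (h : (N : ℤ) ∣ t) : lower t ∈ CongruenceSubgroup.Gamma N := by
  rw [mem_Gamma_iff]; simp [h]

/-- A congruence matrix with a prescribed first row. -/
theorem exists_mem_Gamma {N : ℕ} {a b : ℤ} (ha : (N : ℤ) ∣ a - 1) (hb : (N : ℤ) ∣ b)
    (hab : IsCoprime a b) : ∃ M ∈ CongruenceSubgroup.Gamma N, M 0 0 = a ∧ M 0 1 = b := by
  have haN : IsCoprime a N := by
    obtain ⟨c, hc⟩ := ha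
    rw [show a = 1 + N * c by linarith]
    exact isCoprime_one_left.add_mul_left_left _
  -- Bézout is applied to `a` and `N * b`, which forces the lower left entry to be a multiple of
  -- `N`.
  obtain ⟨u, v, huv⟩ := haN.mul_right hab
  refine ⟨mk a b (-(v * N)) u (by linear_combination huv), ?_, rfl, rfl⟩
  rw [mem_Gamma_iff]
  refine ⟨ha, hb, ⟨-v, by simp; ring⟩, ?_⟩
  obtain ⟨c, hc⟩ := ha
  refine ⟨-(v * b) - u * c, ?_⟩
  simp
  linear_combination huv - u * hc

theorem exists_mk_mem_Gamma {N : ℕ} {a b : ℤ} (ha : (N : ℤ) ∣ a - 1) (hb : (N : ℤ) ∣ b)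
    (hab : IsCoprime a b) : ∃ c d h, mk a b c d h ∈ CongruenceSubgroup.Gamma N ∧
      (N : ℤ) ∣ c ∧ (N : ℤ) ∣ d - 1 := by
  obtain ⟨M, hM, rfl, rfl⟩ := exists_mem_Gamma ha hb hab
  refine ⟨M 1 0, M 1 1, det_eq M, ?_, (mem_Gamma_iff.1 hM).2.2⟩
  have := mem_Gamma_iff.1 hM
  rw [mem_Gamma_iff]
  simpa using this

variable {Q : Type*} [Group Q]

open Classical in
/-- The value of `ψ` on the congruence matrices with first row `(a, b)`. -/
noncomputable def symbol (ψ : SL(2, ℤ) →* Q) (N : ℕ) (a b : ℤ) : Q :=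
  if h : ∃ M ∈ CongruenceSubgroup.Gamma N, M 0 0 = a ∧ M 0 1 = b then ψ h.choose else 1

variable {ψ : SL(2, ℤ) →* Q} {N : ℕ}

/-- Two matrices with the same first row differ by a lower unipotent factor on the left, here of
level `N`. This makes `symbol` independent of the chosen matrix. -/
theorem map_eq_of_row_eq (hl : ∀ t : ℤ, (N : ℤ) ∣ t → ψ (lower t) = 1) {M M' : SL(2, ℤ)}
    (hM : M ∈ CongruenceSubgroup.Gamma N) (hM' : M' ∈ CongruenceSubgroup.Gamma N)
    (h0 : M 0 0 = M' 0 0) (h1 : M 0 1 = M' 0 1) : ψ M = ψ M' := by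
  set t := M' 1 0 * M 1 1 - M' 1 1 * M 1 0 with ht
  have hM1 := det_eq M
  have hM2 := det_eq M'
  have e : M' = lower t * M := by
    ext i j
    fin_cases i <;> fin_cases j <;>
      simp [Matrix.mul_apply, Fin.sum_univ_two, h0, h1, ht] <;>
      generalize M' 0 0 = p at * <;> grind
  have : (N : ℤ) ∣ t := by
    rw [mem_Gamma_iff] at hM hM'
    exact dvd_sub (hM'.2.2.1.mul_right _) (hM.2.2.1.mul_left _)
  rw [e, map_mul, hl t this, one_mul]

theorem map_eq_symbol (hl : ∀ t : ℤ, (N : ℤ) ∣ t → ψ (lower t) = 1) {M : SL(2, ℤ)}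
    (hM : M ∈ CongruenceSubgroup.Gamma N) : ψ M = symbol ψ N (M 0 0) (M 0 1) := by
  have h : ∃ M' ∈ CongruenceSubgroup.Gamma N, M' 0 0 = M 0 0 ∧ M' 0 1 = M 0 1 := ⟨M, hM, rfl, rfl⟩
  rw [symbol, dif_pos h]
  exact map_eq_of_row_eq hl hM h.choose_spec.1 h.choose_spec.2.1.symm h.choose_spec.2.2.symm

theorem map_mk_eq_symbol (hl : ∀ t : ℤ, (N : ℤ) ∣ t → ψ (lower t) = 1) {a b c d : ℤ}
    {h : a * d - b * c = 1} (hM : mk a b c d h ∈ CongruenceSubgroup.Gamma N) :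
    ψ (mk a b c d h) = symbol ψ N a b := by
  rw [map_eq_symbol hl hM]
  rfl

theorem symbol_one (hl : ∀ t : ℤ, (N : ℤ) ∣ t → ψ (lower t) = 1)
    (hu : ∀ t : ℤ, (N : ℤ) ∣ t → ψ (upper t) = 1) {b : ℤ} (hb : (N : ℤ) ∣ b) :
    symbol ψ N 1 b = 1 := by
  rw [← hu b hb, map_eq_symbol hl (upper_mem hb)]
  rfl

theorem symbol_add_right (hl : ∀ t : ℤ, (N : ℤ) ∣ t → ψ (lower t) = 1)
    (hu : ∀ t : ℤ, (N : ℤ) ∣ t → ψ (upper t) = 1) {a b t : ℤ} (ha : (N : ℤ) ∣ a - 1)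
    (hb : (N : ℤ) ∣ b) (hab : IsCoprime a b) (ht : (N : ℤ) ∣ t) :
    symbol ψ N a (b + a * t) = symbol ψ N a b := by
  obtain ⟨M, hM, h0, h1⟩ := exists_mem_Gamma ha hb hab
  have e0 : (M * upper t) 0 0 = a := by
    simp [Matrix.mul_apply, Fin.sum_univ_two, h0]
  have e1 : (M * upper t) 0 1 = b + a * t := by
    simp [Matrix.mul_apply, Fin.sum_univ_two, h0, h1]; ring
  have := map_eq_symbol hl (mul_mem hM (upper_mem ht))
  rw [e0, e1, map_mul, hu t ht, mul_one, map_eq_symbol hl hM, h0, h1] at this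
  exact this.symm

/-- Conjugation by a lower unipotent matrix shifts `a` by a multiple of `b`. Centrality lets `t` be
arbitrary, whereas `symbol_add_right` multiplies by an upper unipotent and needs level `N`. -/
theorem symbol_add_left (hl : ∀ t : ℤ, (N : ℤ) ∣ t → ψ (lower t) = 1)
    (hc : CentralOn ψ (CongruenceSubgroup.Gamma N)) {a b t : ℤ} (ha : (N : ℤ) ∣ a - 1)
    (hb : (N : ℤ) ∣ b) (hab : IsCoprime a b) :
    symbol ψ N (a + b * t) b = symbol ψ N a b := by
  obtain ⟨M, hM, h0, h1⟩ := exists_mem_Gamma ha hb hab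
  have hinv : (lower (-t))⁻¹ = lower t := by
    ext i j
    fin_cases i <;> fin_cases j <;> simp [Matrix.adjugate_fin_two]
  have hmem : lower (-t) * M * (lower (-t))⁻¹ ∈ CongruenceSubgroup.Gamma N :=
    (CongruenceSubgroup.Gamma_normal N).conj_mem M hM _
  have e0 : (lower (-t) * M * (lower (-t))⁻¹) 0 0 = a + b * t := by
    rw [hinv]
    simp [Matrix.mul_apply, Matrix.vecMul, dotProduct, Fin.sum_univ_two, h0, h1]
  have e1 : (lower (-t) * M * (lower (-t))⁻¹) 0 1 = b := by
    rw [hinv]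
    simp [Matrix.mul_apply, Matrix.vecMul, dotProduct, Fin.sum_univ_two, h0, h1]
  have := map_eq_symbol hl hmem
  rw [e0, e1, hc M hM, map_eq_symbol hl hM, h0, h1] at this
  exact this.symm

theorem symbol_eq_one_of_dvd (hl : ∀ t : ℤ, (N : ℤ) ∣ t → ψ (lower t) = 1)
    (hu : ∀ t : ℤ, (N : ℤ) ∣ t → ψ (upper t) = 1)
    (hc : CentralOn ψ (CongruenceSubgroup.Gamma N)) {a b : ℤ} (hb : (N : ℤ) ∣ b)
    (hab : b ∣ a - 1) : symbol ψ N a b = 1 := by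
  obtain ⟨t, ht⟩ := hab
  rw [show a = 1 + b * t by linarith, symbol_add_left hl hc (by simp) hb isCoprime_one_left,
    symbol_one hl hu hb]

end SymbolSL2

/-! ### Multiplicative symbols from `SL₃`. -/

/-- The principal congruence subgroup of level `N` of the special linear group. -/
abbrev slCong (n N : ℕ) : Subgroup (Matrix.SpecialLinearGroup (Fin n) ℤ) :=
  (Matrix.SpecialLinearGroup.map (n := Fin n) (Int.castRingHom (ZMod N))).ker

theorem mem_slCong_iff {n N : ℕ} {M : Matrix.SpecialLinearGroup (Fin n) ℤ} :
    M ∈ slCong n N ↔ ∀ i j, (N : ℤ) ∣ M i j - (1 : Matrix (Fin n) (Fin n) ℤ) i j := by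
  rw [MonoidHom.mem_ker]
  refine (Matrix.SpecialLinearGroup.ext_iff _ _).trans (forall₂_congr fun i j => ?_)
  rw [← ZMod.intCast_zmod_eq_zero_iff_dvd, Int.cast_sub, sub_eq_zero]
  simp [Matrix.one_apply]

/-- The elementary matrix `1 + t E_ij`. -/
def slElem {n : ℕ} {i j : Fin n} (hij : i ≠ j) (t : ℤ) : Matrix.SpecialLinearGroup (Fin n) ℤ :=
  ⟨Matrix.transvection i j t, det_transvection_of_ne i j hij t⟩

@[simp] theorem coe_slElem {n : ℕ} {i j : Fin n} (hij : i ≠ j) (t : ℤ) :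
    (slElem hij t : Matrix (Fin n) (Fin n) ℤ) = Matrix.transvection i j t := rfl

theorem slElem_mem {n N : ℕ} {i j : Fin n} (hij : i ≠ j) {t : ℤ} (ht : (N : ℤ) ∣ t) :
    slElem hij t ∈ slCong n N := by
  rw [mem_slCong_iff]
  intro p q
  simp only [coe_slElem, Matrix.transvection, Matrix.add_apply, add_sub_cancel_left, single_apply]
  split_ifs <;> simp [ht]

/-- The commutator of a level-`N` elementary matrix with an integral one is again elementary of
level `N`, and `φ` kills it by centrality. A third index is needed. -/
theorem map_slElem_eq_one {n N : ℕ} {Q : Type*} [Group Q]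
    {φ : Matrix.SpecialLinearGroup (Fin n) ℤ →* Q} (hφ : CentralOn φ (slCong n N)) {i j k : Fin n}
    (hij : i ≠ j) (hik : i ≠ k) (hkj : k ≠ j) {t : ℤ} (ht : (N : ℤ) ∣ t) :
    φ (slElem hij t) = 1 := by
  have e : slElem hkj (-1) * slElem hik t = slElem hik t * slElem hij t * slElem hkj (-1) := by
    apply Subtype.ext
    simp only [Matrix.SpecialLinearGroup.coe_mul, coe_slElem]
    simp [Matrix.transvection, add_mul, mul_add, single_mul_single_of_ne, hij.symm, hik.symm,
      hkj.symm]
    rw [← single_neg i j t]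
    abel
  have := hφ _ (slElem_mem hik ht) (slElem hkj (-1))
  rw [e, mul_inv_cancel_right, map_mul] at this
  simpa using this

namespace SymbolSL3
open SymbolSL2

/-- The upper left corner `SL₂ ⊂ SL₃`. -/
def corner : SL(2, ℤ) →* SL(3, ℤ) where
  toFun M := ⟨!![M 0 0, M 0 1, 0; M 1 0, M 1 1, 0; 0, 0, 1], by
    simp [det_fin_three]; linear_combination det_eq M⟩
  map_one' := by ext i j; fin_cases i <;> fin_cases j <;> rfl
  map_mul' M M' := by
    apply Subtype.ext
    change _ = !![M 0 0, M 0 1, 0; M 1 0, M 1 1, 0; 0, 0, 1] *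
      !![M' 0 0, M' 0 1, 0; M' 1 0, M' 1 1, 0; 0, 0, 1]
    ext i j
    fin_cases i <;> fin_cases j <;> simp [Matrix.mul_apply, Fin.sum_univ_succ]

@[simp] theorem coe_corner (M : SL(2, ℤ)) : (corner M : Matrix (Fin 3) (Fin 3) ℤ) =
    !![M 0 0, M 0 1, 0; M 1 0, M 1 1, 0; 0, 0, 1] := rfl

theorem corner_mem {N : ℕ} {M : SL(2, ℤ)} (hM : M ∈ CongruenceSubgroup.Gamma N) :
    corner M ∈ slCong 3 N := by
  rw [mem_Gamma_iff] at hM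
  rw [mem_slCong_iff]
  intro i j
  fin_cases i <;> fin_cases j <;> simp [hM]

variable {Q : Type*} [Group Q] {φ : SL(3, ℤ) →* Q} {N : ℕ}

theorem centralOn_corner (hφ : CentralOn φ (slCong 3 N)) :
    CentralOn (φ.comp corner) (CongruenceSubgroup.Gamma N) :=
  hφ.comp corner fun _ h => corner_mem h

theorem map_elem (hφ : CentralOn φ (slCong 3 N)) {i j : Fin 3} (hij : i ≠ j) {t : ℤ}
    (ht : (N : ℤ) ∣ t) : φ (slElem hij t) = 1 := by
  obtain ⟨k, hik, hkj⟩ : ∃ k : Fin 3, i ≠ k ∧ k ≠ j := by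
    revert i j; decide
  exact map_slElem_eq_one hφ hij hik hkj ht

theorem map_corner_lower (hφ : CentralOn φ (slCong 3 N)) (t : ℤ) (ht : (N : ℤ) ∣ t) :
    (φ.comp corner) (lower t) = 1 := by
  rw [← map_elem hφ (show (1 : Fin 3) ≠ 0 by decide) ht]
  refine congrArg φ ?_
  ext i j
  fin_cases i <;> fin_cases j <;> simp [Matrix.transvection]

theorem map_corner_upper (hφ : CentralOn φ (slCong 3 N)) (t : ℤ) (ht : (N : ℤ) ∣ t) :
    (φ.comp corner) (upper t) = 1 := by
  rw [← map_elem hφ (show (0 : Fin 3) ≠ 1 by decide) ht]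
  refine congrArg φ ?_
  ext i j
  fin_cases i <;> fin_cases j <;> simp [Matrix.transvection]

/-- The cyclic permutation matrix moving the corner from the coordinates `0, 1` to `2, 0`. -/
def cyc : SL(3, ℤ) := ⟨!![0, 1, 0; 0, 0, 1; 1, 0, 0], by simp [det_fin_three]⟩

/-- The signed permutation matrix moving the corner to the coordinates `0, 2`. -/
def swap : SL(3, ℤ) := ⟨!![1, 0, 0; 0, 0, -1; 0, 1, 0], by simp [det_fin_three]⟩

/-- The signed permutation matrix moving the corner to the coordinates `2, 1`. -/
def flip : SL(3, ℤ) := ⟨!![0, 0, 1; 0, -1, 0; 1, 0, 0], by simp [det_fin_three]⟩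

@[simp] theorem coe_cyc : (cyc : Matrix (Fin 3) (Fin 3) ℤ) = !![0, 1, 0; 0, 0, 1; 1, 0, 0] := rfl
@[simp] theorem coe_swap : (swap : Matrix (Fin 3) (Fin 3) ℤ) = !![1, 0, 0; 0, 0, -1; 0, 1, 0] := rfl
@[simp] theorem coe_flip : (flip : Matrix (Fin 3) (Fin 3) ℤ) = !![0, 0, 1; 0, -1, 0; 1, 0, 0] := rfl

theorem coe_cyc_inv : ((cyc⁻¹ : SL(3, ℤ)) : Matrix (Fin 3) (Fin 3) ℤ) = !![0, 0, 1; 1, 0, 0; 0, 1, 0] := by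
  rw [Matrix.SpecialLinearGroup.coe_inv, coe_cyc, adjugate_fin_three]
  simp
theorem coe_swap_inv : ((swap⁻¹ : SL(3, ℤ)) : Matrix (Fin 3) (Fin 3) ℤ) = !![1, 0, 0; 0, 0, 1; 0, -1, 0] := by
  rw [Matrix.SpecialLinearGroup.coe_inv, coe_swap, adjugate_fin_three]
  simp
theorem coe_flip_inv : ((flip⁻¹ : SL(3, ℤ)) : Matrix (Fin 3) (Fin 3) ℤ) = !![0, 0, 1; 0, -1, 0; 1, 0, 0] := by
  rw [Matrix.SpecialLinearGroup.coe_inv, coe_flip, adjugate_fin_three]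
  simp

theorem coe_cyc_conj (M : SL(2, ℤ)) :
    ((cyc * corner M * cyc⁻¹ : SL(3, ℤ)) : Matrix (Fin 3) (Fin 3) ℤ) =
      !![M 1 1, 0, M 1 0; 0, 1, 0; M 0 1, 0, M 0 0] := by
  rw [Matrix.SpecialLinearGroup.coe_mul, Matrix.SpecialLinearGroup.coe_mul, coe_cyc_inv]
  ext i j
  fin_cases i <;> fin_cases j <;> simp

theorem coe_swap_conj (M : SL(2, ℤ)) :
    ((swap * corner M * swap⁻¹ : SL(3, ℤ)) : Matrix (Fin 3) (Fin 3) ℤ) =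
      !![M 0 0, 0, M 0 1; 0, 1, 0; M 1 0, 0, M 1 1] := by
  rw [Matrix.SpecialLinearGroup.coe_mul, Matrix.SpecialLinearGroup.coe_mul, coe_swap_inv]
  ext i j
  fin_cases i <;> fin_cases j <;> simp

theorem coe_flip_conj (M : SL(2, ℤ)) :
    ((flip * corner M * flip⁻¹ : SL(3, ℤ)) : Matrix (Fin 3) (Fin 3) ℤ) =
      !![1, 0, 0; 0, M 1 1, -M 1 0; 0, -M 0 1, M 0 0] := by
  rw [Matrix.SpecialLinearGroup.coe_mul, Matrix.SpecialLinearGroup.coe_mul, coe_flip_inv]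
  ext i j
  fin_cases i <;> fin_cases j <;> simp

/-- Multiplicativity of the symbol in its second entry. -/
theorem symbol_mul_right (hφ : CentralOn φ (slCong 3 N)) {a b c : ℤ} (ha : (N : ℤ) ∣ a - 1)
    (hb : (N : ℤ) ∣ b) (hc : (N : ℤ) ∣ c) (hab : IsCoprime a b) (hac : IsCoprime a c) :
    symbol (φ.comp corner) N a (b * c) =
      symbol (φ.comp corner) N a b * symbol (φ.comp corner) N a c := by
  obtain ⟨c₁, t₁, d₁, h₁, hc₁, ht₁⟩ := exists_mk_mem_Gamma ha hb hab
  obtain ⟨c₂, t₂, d₂, h₂, hc₂, ht₂⟩ := exists_mk_mem_Gamma ha hc hac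
  have hl := map_corner_lower hφ
  have d₃ : a * (t₁ - b * c₁ * t₂) - b * c * -(c₁ * c₂) = 1 := by
    linear_combination d₁ + b * c₁ * (-d₂)
  have h₃ : mk a (b * c) (-(c₁ * c₂)) (t₁ - b * c₁ * t₂) d₃ ∈ CongruenceSubgroup.Gamma N := by
    rw [mk_mem_Gamma_iff]
    refine ⟨ha, hb.mul_right c, (hc₁.mul_right c₂).neg_right, ?_⟩
    exact (dvd_sub ht₁ ((hb.mul_right c₁).mul_right t₂)).trans (Eq.dvd (by ring))
  -- The matrices with rows `(a, b)` and `(a, c)` are placed in two different coordinate planes. Up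
  -- to elementary factors of level `N`, their product is a copy of a matrix with row `(a, b * c)`;
  -- conjugations by signed permutations are invisible to `φ`.
  have key : corner (mk a b c₁ t₁ d₁) * (cyc * corner (mk a c c₂ t₂ d₂) * cyc⁻¹) =
      slElem (show (0 : Fin 3) ≠ 2 by decide) c₂ *
      slElem (show (1 : Fin 3) ≠ 0 by decide) (c₁ * t₂) *
      slElem (show (2 : Fin 3) ≠ 0 by decide) c *
      (flip * corner (mk a (b * c) (-(c₁ * c₂)) (t₁ - b * c₁ * t₂) d₃) * flip⁻¹) *
      slElem (show (0 : Fin 3) ≠ 1 by decide) b := by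
    apply Subtype.ext
    have s₁ := coe_cyc_conj (mk a c c₂ t₂ d₂)
    have s₂ := coe_flip_conj (mk a (b * c) (-(c₁ * c₂)) (t₁ - b * c₁ * t₂) d₃)
    generalize cyc * corner (mk a c c₂ t₂ d₂) * cyc⁻¹ = X₁ at *
    generalize flip * corner (mk a (b * c) (-(c₁ * c₂)) (t₁ - b * c₁ * t₂) d₃) * flip⁻¹ = X₂ at *
    simp only [Matrix.SpecialLinearGroup.coe_mul, s₁, s₂]
    ext i j
    fin_cases i <;> fin_cases j <;>
      simp [Matrix.mul_apply, Fin.sum_univ_three, Matrix.transvection] <;> grind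
  have hk := congrArg φ key
  rw [map_mul φ (corner _), hφ _ (corner_mem h₂), map_mul, map_mul, map_mul, map_mul, hφ _ (corner_mem h₃),
    map_elem hφ _ hc₂, map_elem hφ _ (hc₁.mul_right _), map_elem hφ _ hc, map_elem hφ _ hb, one_mul,
    one_mul, one_mul, mul_one] at hk
  rw [← map_mk_eq_symbol hl h₁, ← map_mk_eq_symbol hl h₂, ← map_mk_eq_symbol hl h₃]
  exact hk.symm

/-- Multiplicativity of the symbol in its first entry. -/
theorem symbol_mul_left (hφ : CentralOn φ (slCong 3 N)) {a b c : ℤ} (ha : (N : ℤ) ∣ a - 1)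
    (hb : (N : ℤ) ∣ b - 1) (hc : (N : ℤ) ∣ c) (hac : IsCoprime a c) (hbc : IsCoprime b c) :
    symbol (φ.comp corner) N (a * b) c =
      symbol (φ.comp corner) N a c * symbol (φ.comp corner) N b c := by
  have hab : (N : ℤ) ∣ a * b - 1 := by
    exact (dvd_add (ha.mul_right b) hb).trans (Eq.dvd (by ring))
  obtain ⟨c₁, t₁, d₁, h₁, hc₁, ht₁⟩ := exists_mk_mem_Gamma ha hc hac
  obtain ⟨c₂, t₂, d₂, h₂, hc₂, ht₂⟩ := exists_mk_mem_Gamma hb hc hbc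
  obtain ⟨c₃, t₃, d₃, h₃, hc₃, ht₃⟩ := exists_mk_mem_Gamma hab hc (hac.mul_left hbc)
  have hl := map_corner_lower hφ
  have hu := map_corner_upper hφ
  have hz : t₂ * (b - a * c₂ * c) - c₂ * c * -(a * t₂ - 1) = 1 := by
    linear_combination d₂
  have h₄ : mk t₂ (c₂ * c) (-(a * t₂ - 1)) (b - a * c₂ * c) hz ∈ CongruenceSubgroup.Gamma N := by
    rw [mk_mem_Gamma_iff]
    refine ⟨ht₂, hc.mul_left c₂, ?_, ?_⟩
    · exact (dvd_add (ha.mul_right t₂) ht₂).neg_right.trans (Eq.dvd (by ring))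
    · exact (dvd_sub hb (hc.mul_left (a * c₂))).trans (Eq.dvd (by ring))
  -- The determinant gives `c₂ * c = t₂ * b - 1`, which differs from `t₂ - 1` by `t₂` times a
  -- multiple of `N`.
  have hs : symbol (φ.comp corner) N t₂ (c₂ * c) = 1 := by
    have e : c₂ * c = (t₂ - 1) + t₂ * (b - 1) := by linear_combination -d₂
    have hco : IsCoprime t₂ (t₂ - 1) := ⟨1, -1, by ring⟩
    rw [e, symbol_add_right hl hu ht₂ ht₂ hco hb]
    exact symbol_eq_one_of_dvd hl hu (centralOn_corner hφ) ht₂ dvd_rfl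
  have key : slElem (show (1 : Fin 3) ≠ 2 by decide) a *
      (corner (mk a c c₁ t₁ d₁) * (swap * corner (mk b c c₂ t₂ d₂) * swap⁻¹)) =
      slElem (show (1 : Fin 3) ≠ 0 by decide) ((c₁ * b + a * c₂) * t₃ - t₁ * c₃) *
      slElem (show (2 : Fin 3) ≠ 0 by decide) (c₂ * t₃) *
      (flip * corner (mk t₂ (c₂ * c) (-(a * t₂ - 1)) (b - a * c₂ * c) hz) * flip⁻¹) *
      corner (mk (a * b) c c₃ t₃ d₃) * slElem (show (1 : Fin 3) ≠ 2 by decide) a := by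
    apply Subtype.ext
    have s₁ := coe_swap_conj (mk b c c₂ t₂ d₂)
    have s₂ := coe_flip_conj (mk t₂ (c₂ * c) (-(a * t₂ - 1)) (b - a * c₂ * c) hz)
    generalize swap * corner (mk b c c₂ t₂ d₂) * swap⁻¹ = X₁ at *
    generalize flip * corner (mk t₂ (c₂ * c) (-(a * t₂ - 1)) (b - a * c₂ * c) hz) * flip⁻¹ = X₂ at *
    simp only [Matrix.SpecialLinearGroup.coe_mul, s₁, s₂]
    ext i j
    fin_cases i <;> fin_cases j <;>
      simp [Matrix.mul_apply, Fin.sum_univ_three, Matrix.transvection] <;> grind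
  have hk := congrArg φ key
  have hd : (N : ℤ) ∣ (c₁ * b + a * c₂) * t₃ - t₁ * c₃ :=
    dvd_sub ((dvd_add (hc₁.mul_right b) (hc₂.mul_left a)).mul_right t₃) (hc₃.mul_left t₁)
  have hn : (slCong 3 N).Normal := MonoidHom.normal_ker _
  -- The elementary matrix with entry `a` is not of level `N`, but it stands on both sides of `key`.
  -- Its image commutes with that of a congruence matrix and so cancels.
  rw [map_mul, hφ.map_mul_comm
      (mul_mem (corner_mem h₁) (hn.conj_mem _ (corner_mem h₂) swap)),
    map_mul φ (corner _), hφ _ (corner_mem h₂), map_mul φ _ (slElem _ a), mul_left_inj, map_mul, map_mul, map_mul,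
    hφ _ (corner_mem h₄), map_elem hφ _ hd, map_elem hφ _ (hc₂.mul_right _), one_mul, one_mul,
    show φ (corner (mk t₂ (c₂ * c) (-(a * t₂ - 1)) (b - a * c₂ * c) hz)) = _ from
      map_mk_eq_symbol hl h₄, hs, one_mul] at hk
  rw [← map_mk_eq_symbol hl h₁, ← map_mk_eq_symbol hl h₂, ← map_mk_eq_symbol hl h₃]
  exact hk.symm
end SymbolSL3

namespace SymbolSL2
variable {Q : Type*} [Group Q] {ψ : SL(2, ℤ) →* Q} {N : ℕ}

theorem symbol_congr_right (hl : ∀ t : ℤ, (N : ℤ) ∣ t → ψ (lower t) = 1)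
    (hu : ∀ t : ℤ, (N : ℤ) ∣ t → ψ (upper t) = 1) {a b b' : ℤ} (ha : (N : ℤ) ∣ a - 1)
    (hb : (N : ℤ) ∣ b) (hab : IsCoprime a b) (h : a * N ∣ b' - b) :
    symbol ψ N a b' = symbol ψ N a b := by
  obtain ⟨t, ht⟩ := h
  rw [show b' = b + a * (N * t) by linear_combination ht]
  exact symbol_add_right hl hu ha hb hab (dvd_mul_right _ _)

theorem symbol_congr_left (hl : ∀ t : ℤ, (N : ℤ) ∣ t → ψ (lower t) = 1)
    (hc : CentralOn ψ (CongruenceSubgroup.Gamma N)) {a a' b : ℤ} (ha : (N : ℤ) ∣ a - 1)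
    (hb : (N : ℤ) ∣ b) (hab : IsCoprime a b) (h : b ∣ a' - a) :
    symbol ψ N a' b = symbol ψ N a b := by
  obtain ⟨t, ht⟩ := h
  rw [show a' = a + b * t by linear_combination ht]
  exact symbol_add_left hl hc ha hb hab

end SymbolSL2

namespace SymbolSL3
open SymbolSL2

variable {Q : Type*} [Group Q] {φ : SL(3, ℤ) →* Q} {n : ℕ}

theorem isCoprime_pow_mul {x a : ℤ} (ha : a ≡ 1 [ZMOD 2 ^ n]) (hx : IsCoprime x a) :
    IsCoprime a (2 ^ n * x) := by
  refine IsCoprime.mul_right ?_ hx.symm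
  obtain ⟨c, hc⟩ := Int.modEq_iff_dvd.1 ha.symm
  rw [show a = 1 + 2 ^ n * c by linarith]
  exact isCoprime_one_left.add_mul_left_left _

/-- The symbols `(a, 2 ^ n * x)` satisfy all hypotheses of `mennicke_symbol_eq_one`. -/
theorem map_corner_eq_one (hn : 1 ≤ n) (hφ : CentralOn φ (slCong 3 (2 ^ n))) {M : SL(2, ℤ)}
    (hM : M ∈ CongruenceSubgroup.Gamma (2 ^ n)) : φ (corner M) = 1 := by
  have hl := map_corner_lower hφ
  have hu := map_corner_upper hφ
  have hc := centralOn_corner hφ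
  have hN : ((2 ^ n : ℕ) : ℤ) = 2 ^ n := by push_cast; rfl
  have dvd_of : ∀ {a : ℤ}, a ≡ 1 [ZMOD 2 ^ n] → ((2 ^ n : ℕ) : ℤ) ∣ a - 1 := fun {a} h => by
    rw [hN]; exact Int.modEq_iff_dvd.1 h.symm
  have dm : ∀ x : ℤ, ((2 ^ n : ℕ) : ℤ) ∣ 2 ^ n * x := fun x => by rw [hN]; exact dvd_mul_right _ _
  have hone : ∀ a : ℤ, a ≡ 1 [ZMOD 2 ^ n] → symbol (φ.comp corner) (2 ^ n) a (2 ^ n * 1) = 1 := by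
    intro a ha
    exact symbol_eq_one_of_dvd hl hu hc (dm 1) (by rw [mul_one]; exact Int.modEq_iff_dvd.1 ha.symm)
  -- A spare factor `2 ^ n` can be inserted at no cost; it converts multiplicativity in the second
  -- entry into multiplicativity in `x`.
  have hcancel : ∀ x a, a ≡ 1 [ZMOD 2 ^ n] → IsCoprime x a →
      symbol (φ.comp corner) (2 ^ n) a ((2 ^ n * 1) * (2 ^ n * x)) =
        symbol (φ.comp corner) (2 ^ n) a (2 ^ n * x) := by
    intro x a ha hx
    rw [symbol_mul_right hφ (dvd_of ha) (dm _) (dm _) (isCoprime_pow_mul ha isCoprime_one_left)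
      (isCoprime_pow_mul ha hx), hone a ha, one_mul]
  have triv : ∀ x a, a ≡ 1 [ZMOD 2 ^ n] → IsCoprime x a →
      symbol (φ.comp corner) (2 ^ n) a (2 ^ n * x) = 1 := by
    intro x a ha hx
    refine mennicke_symbol_eq_one hn (fun x a => symbol (φ.comp corner) (2 ^ n) a (2 ^ n * x))
      hone ?_ ?_ ?_ ?_ ?_ ?_ x a ha hx
    · intro a ha
      refine symbol_eq_one_of_dvd hl hu hc (dm _) ?_
      rw [mul_neg_one, neg_dvd]
      exact Int.modEq_iff_dvd.1 ha.symm
    · intro x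
      exact symbol_one hl hu (dm x)
    · intro x y a ha hx hxy
      obtain ⟨t, ht⟩ := Int.modEq_iff_dvd.1 hxy
      refine (symbol_congr_right hl hu (dvd_of ha) (dm _) (isCoprime_pow_mul ha hx) ⟨t, ?_⟩).symm
      rw [hN]
      linear_combination 2 ^ n * ht
    · intro x a b ha hx hab
      exact (symbol_congr_left hl hc (dvd_of ha) (dm _) (isCoprime_pow_mul ha hx)
        (Int.modEq_iff_dvd.1 hab)).symm
    · intro x y a ha hx hy
      rw [← hcancel _ _ ha (hx.mul_left hy), ← symbol_mul_right hφ (dvd_of ha) (dm _) (dm _)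
        (isCoprime_pow_mul ha hx) (isCoprime_pow_mul ha hy)]
      congr 1
      ring
    · intro x a b ha hb hxa hxb
      exact symbol_mul_left hφ (dvd_of ha) (dvd_of hb) (dm _) (isCoprime_pow_mul ha hxa)
        (isCoprime_pow_mul hb hxb)
  have hm := mem_Gamma_iff.1 hM
  have hd := det_eq M
  obtain ⟨x, hx⟩ := hm.2.1
  rw [hN] at hx
  have h0 : M 0 0 ≡ 1 [ZMOD 2 ^ n] := by
    have := hm.1
    rw [hN] at this
    exact (Int.modEq_iff_dvd.2 this).symm
  rw [← MonoidHom.comp_apply, map_eq_symbol hl hM, hx]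
  refine triv x _ h0 ⟨-(2 ^ n * M 1 0), M 1 1, ?_⟩
  rw [hx] at hd
  linear_combination hd

end SymbolSL3

/-! ### Elementary symplectic matrices of level `N` are killed. -/

namespace Sp

variable {g : ℕ} {R : Type} [CommRing R]

/-- The principal congruence subgroup of level `N` of the integral symplectic group. -/
abbrev cong (g N : ℕ) : Subgroup (Sp g ℤ) := (Sp.reduction g N).ker

theorem mem_cong_iff {N : ℕ} {X : Sp g ℤ} :
    X ∈ cong g N ↔ ∀ p q, (N : ℤ) ∣ X.1 p q - (1 : Matrix (Fin g ⊕ Fin g) (Fin g ⊕ Fin g) ℤ) p q := by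
  rw [MonoidHom.mem_ker, Subtype.ext_iff, ← Matrix.ext_iff]
  refine forall₂_congr fun i j => ?_
  rw [← ZMod.intCast_zmod_eq_zero_iff_dvd, Int.cast_sub, sub_eq_zero]
  simp [Matrix.one_apply, Sp.reduction]

/-- The unipotent element `(1, B; 0, 1)` for symmetric `B`. -/
def up (B : Matrix (Fin g) (Fin g) R) (h : Bᵀ = B) : Sp g R :=
  ⟨fromBlocks 1 B 0 1, by rw [SymplecticGroup.fromBlocks_mem_iff]; simp [h]⟩

/-- The unipotent element `(1, 0; C, 1)` for symmetric `C`. -/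
def low (C : Matrix (Fin g) (Fin g) R) (h : Cᵀ = C) : Sp g R :=
  ⟨fromBlocks 1 0 C 1, by rw [SymplecticGroup.fromBlocks_mem_iff]; simp [h]⟩

/-- The element `(A, 0; 0, (A⁻¹)ᵀ)` for invertible `A`. -/
def levi : (Matrix (Fin g) (Fin g) R)ˣ →* Sp g R where
  toFun A := ⟨fromBlocks A.1 0 0 (A⁻¹).1ᵀ, by
    rw [SymplecticGroup.fromBlocks_mem_iff]; simp [← transpose_mul]⟩
  map_one' := Subtype.ext (by simp)
  map_mul' A B := Subtype.ext (by simp [fromBlocks_multiply])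

@[simp] theorem coe_up (B : Matrix (Fin g) (Fin g) R) (h : Bᵀ = B) :
    (up B h).1 = fromBlocks 1 B 0 1 := rfl

@[simp] theorem coe_low (B : Matrix (Fin g) (Fin g) R) (h : Bᵀ = B) :
    (low B h).1 = fromBlocks 1 0 B 1 := rfl

@[simp] theorem coe_levi (A : (Matrix (Fin g) (Fin g) R)ˣ) :
    (levi A).1 = fromBlocks A.1 0 0 (A⁻¹).1ᵀ := rfl

theorem up_mul_up {B B' : Matrix (Fin g) (Fin g) R} (h : Bᵀ = B) (h' : B'ᵀ = B') :
    up B h * up B' h' = up (B + B') (by rw [transpose_add, h, h']) :=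
  Subtype.ext (by simp [fromBlocks_multiply, add_comm])

theorem levi_mul_up (A : (Matrix (Fin g) (Fin g) R)ˣ) {B : Matrix (Fin g) (Fin g) R} (h : Bᵀ = B) :
    levi A * up B h * (levi A)⁻¹ =
      up (A.1 * B * A.1ᵀ) (by simp [h, mul_assoc]) := by
  rw [mul_inv_eq_iff_eq_mul]
  refine Subtype.ext ?_
  simp only [Submonoid.coe_mul, coe_levi, coe_up, fromBlocks_multiply]
  simp [mul_assoc, ← transpose_mul]

theorem symJ_mul_up {B : Matrix (Fin g) (Fin g) R} (h : Bᵀ = B) :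
    SymplecticGroup.symJ (Fin g) R * up B h * (SymplecticGroup.symJ (Fin g) R)⁻¹ =
      low (-B) (by rw [transpose_neg, h]) := by
  rw [mul_inv_eq_iff_eq_mul]
  refine Subtype.ext ?_
  simp [J, fromBlocks_multiply]

theorem up_mem_cong {N : ℕ} {B : Matrix (Fin g) (Fin g) ℤ} (h : Bᵀ = B)
    (hB : ∀ i j, (N : ℤ) ∣ B i j) : up B h ∈ cong g N := by
  rw [mem_cong_iff, ← fromBlocks_one]
  rintro (p | p) (q | q) <;> simp [hB]

theorem low_mem_cong {N : ℕ} {B : Matrix (Fin g) (Fin g) ℤ} (h : Bᵀ = B)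
    (hB : ∀ i j, (N : ℤ) ∣ B i j) : low B h ∈ cong g N := by
  rw [mem_cong_iff, ← fromBlocks_one]
  rintro (p | p) (q | q) <;> simp [hB]

theorem levi_mem_cong {N : ℕ} {A : (Matrix (Fin g) (Fin g) ℤ)ˣ}
    (hA : ∀ i j, (N : ℤ) ∣ A.1 i j - (1 : Matrix (Fin g) (Fin g) ℤ) i j)
    (hA' : ∀ i j, (N : ℤ) ∣ (A⁻¹).1 i j - (1 : Matrix (Fin g) (Fin g) ℤ) i j) :
    levi A ∈ cong g N := by
  rw [mem_cong_iff, ← fromBlocks_one]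
  rintro (p | p) (q | q)
  · simp [hA]
  · simp
  · simp
  · have := hA' q p
    rw [← transpose_one] at this
    simpa using this

/-- The matrix `1 + y e_kᵀ`, where `y_k = 0`. -/
def colUnit (k : Fin g) (y : Fin g → R) (hy : y k = 0) : (Matrix (Fin g) (Fin g) R)ˣ where
  val := 1 + vecMulVec y (Pi.single k 1)
  inv := 1 - vecMulVec y (Pi.single k 1)
  val_inv := by
    simp [mul_sub, add_mul, vecMulVec_mul_vecMulVec, hy]
  inv_val := by
    simp [mul_add, sub_mul, vecMulVec_mul_vecMulVec, hy]

theorem coe_colUnit (k : Fin g) (y : Fin g → R) (hy : y k = 0) :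
    (colUnit k y hy).1 = 1 + vecMulVec y (Pi.single k 1) := rfl

theorem coe_inv_colUnit (k : Fin g) (y : Fin g → R) (hy : y k = 0) :
    ((colUnit k y hy)⁻¹).1 = 1 - vecMulVec y (Pi.single k 1) := rfl

theorem levi_colUnit_mem_cong {N : ℕ} (k : Fin g) {y : Fin g → ℤ} (hy : y k = 0)
    (hN : ∀ i, (N : ℤ) ∣ y i) : levi (colUnit k y hy) ∈ cong g N := by
  refine levi_mem_cong (fun i j => ?_) fun i j => ?_
  · simp [coe_colUnit, vecMulVec_apply, (hN i).mul_right]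
  · rw [coe_inv_colUnit]
    simp [vecMulVec_apply, (hN i).mul_right]

theorem colUnit_mul_colUnit (k : Fin g) {y z : Fin g → R} (hy : y k = 0) (hz : z k = 0) :
    colUnit k y hy * colUnit k z hz = colUnit k (y + z) (by simp [hy, hz]) := by
  apply Units.ext
  simp [coe_colUnit, mul_add, add_mul, vecMulVec_mul_vecMulVec, hz, add_vecMulVec]
  abel

section kill

variable {Q : Type*} [Group Q] {N : ℕ} {φ : Sp g ℤ →* Q}

theorem exists_ne_ne (hg : 3 ≤ g) (i j : Fin g) : ∃ k : Fin g, k ≠ i ∧ k ≠ j := by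
  have : ({i, j} : Finset (Fin g)).card < (Finset.univ : Finset (Fin g)).card := by
    refine lt_of_le_of_lt Finset.card_le_two ?_
    rw [Finset.card_univ, Fintype.card_fin]; omega
  obtain ⟨k, -, hk⟩ := Finset.exists_mem_notMem_of_card_lt_card this
  exact ⟨k, by simpa using hk⟩

theorem map_levi_colUnit_eq_one (hg : 3 ≤ g) (hφ : CentralOn φ (cong g N)) (k : Fin g)
    {y : Fin g → ℤ} (hy : y k = 0) (hN : ∀ i, (N : ℤ) ∣ y i) :
    φ (levi (colUnit k y hy)) = 1 := by
  -- When `y` also vanishes at `m`, `colUnit k y` is a commutator of `colUnit m y` with an integral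
  -- elementary matrix.
  have key : ∀ (m : Fin g) (y : Fin g → ℤ) (hy : y k = 0), m ≠ k → y m = 0 →
      (∀ i, (N : ℤ) ∣ y i) → φ (levi (colUnit k y hy)) = 1 := by
    intro m y hy hmk hm hN
    have hs : (Pi.single m (-1) : Fin g → ℤ) k = 0 := by simp [hmk.symm]
    have e : colUnit k (Pi.single m (-1)) hs * colUnit m y hm =
        colUnit m y hm * colUnit k y hy * colUnit k (Pi.single m (-1)) hs := by
      apply Units.ext
      simp only [Units.val_mul, coe_colUnit, mul_add, add_mul, vecMulVec_mul_vecMulVec, one_mul,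
        mul_one]
      simp [hmk, hy, hm]
      abel
    have h := hφ.map_mul_comm (levi_colUnit_mem_cong m hm hN) (levi (colUnit k (Pi.single m (-1)) hs))
    rw [← map_mul, ← map_mul levi, e, map_mul, map_mul, map_mul, map_mul, mul_left_inj] at h
    simpa using h
  -- A general `y` is split into its part off `m` and its part at `m`; the latter vanishes at a
  -- third index `m'`.
  obtain ⟨m, hmk, -⟩ := exists_ne_ne hg k k
  obtain ⟨m', hm'k, hm'm⟩ := exists_ne_ne hg k m
  have h1 : (y - (Pi.single m (y m) : Fin g → ℤ)) k = 0 := by simp [hy, hmk.symm]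
  have h2 : (Pi.single m (y m) : Fin g → ℤ) k = 0 := by simp [hmk.symm]
  have e : colUnit k y hy = colUnit k _ h1 * colUnit k _ h2 := by
    rw [colUnit_mul_colUnit]
    simp
  rw [e, map_mul, map_mul, key m _ h1 hmk (by simp) ?_, key m' _ h2 hm'k (by simp [hm'm]) ?_, one_mul]
  · intro i
    by_cases h : i = m
    · subst h; simp [hN]
    · simp [h]
  · intro i
    by_cases h : i = m
    · subst h; simp
    · simp [h, hN]

theorem map_up_conj (hφ : CentralOn φ (cong g N)) (A : (Matrix (Fin g) (Fin g) ℤ)ˣ)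
    {B : Matrix (Fin g) (Fin g) ℤ} (h : Bᵀ = B) (hB : ∀ i j, (N : ℤ) ∣ B i j)
    {B' : Matrix (Fin g) (Fin g) ℤ} (h' : B'ᵀ = B') (e : A.1 * B * A.1ᵀ = B + B') :
    φ (up B' h') = 1 := by
  have := hφ _ (up_mem_cong h hB) (levi A)
  rw [levi_mul_up] at this
  have h2 : up (A.1 * B * A.1ᵀ) (by simp [h, mul_assoc]) = up B h * up B' h' := by
    rw [up_mul_up]
    exact Subtype.ext (by simp [e])
  rw [h2, map_mul] at this
  simpa using this

/-- Conjugating `t (E_ij + E_ji)` by `1 + E_lj` adds exactly `t (E_il + E_li)`, provided `j` is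
distinct from `i` and `l`. -/
theorem map_up_offDiag (hg : 3 ≤ g) (hφ : CentralOn φ (cong g N)) {i l : Fin g}
    {t : ℤ} (ht : (N : ℤ) ∣ t) (h) : φ (up (single i l t + single l i t) h) = 1 := by
  obtain ⟨j, hji, hjl⟩ := exists_ne_ne hg i l
  have hs : (Pi.single l 1 : Fin g → ℤ) j = 0 := by simp [hjl]
  refine map_up_conj hφ (colUnit j (Pi.single l 1) hs) (B := single i j t + single j i t)
    (by simp [add_comm]) ?_ h ?_
  · intro p q
    simp only [Matrix.add_apply, single_apply]
    refine dvd_add ?_ ?_ <;> split_ifs <;> simp [ht]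
  · rw [coe_colUnit, ← single_eq_single_vecMulVec_single]
    simp [add_mul, mul_add, hji, hji.symm]
    abel

/-- Conjugating `t E_jj` by `1 + E_lj` adds `t E_ll` and an off-diagonal symmetric term, which is
already killed. -/
theorem map_up_diag (hg : 3 ≤ g) (hφ : CentralOn φ (cong g N)) (l : Fin g)
    {t : ℤ} (ht : (N : ℤ) ∣ t) (h) : φ (up (single l l t) h) = 1 := by
  obtain ⟨j, hjl, -⟩ := exists_ne_ne hg l l
  have hs : (Pi.single l 1 : Fin g → ℤ) j = 0 := by simp [hjl]
  have hsym : (single j l t + single l j t)ᵀ = single j l t + single l j t := by simp [add_comm]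
  have := map_up_conj hφ (colUnit j (Pi.single l 1) hs) (B := single j j t)
    (by simp) (fun p q => by simp only [single_apply]; split_ifs <;> simp [ht])
    (B' := single j l t + single l j t + single l l t) (by simp [add_comm]) (by
      rw [coe_colUnit, ← single_eq_single_vecMulVec_single]
      simp [add_mul, mul_add]
      abel)
  rw [← up_mul_up hsym h, map_mul, map_up_offDiag hg hφ ht, one_mul] at this
  exact this

theorem map_up_sum {ι : Type*} (s : Finset ι) (f : ι → Matrix (Fin g) (Fin g) ℤ)
    (hs : ∀ i, (f i)ᵀ = f i) (hf : ∀ i ∈ s, φ (up (f i) (hs i)) = 1) (h) :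
    φ (up (∑ i ∈ s, f i) h) = 1 := by
  classical
  induction s using Finset.induction_on with
  | empty =>
    rw [← map_one φ]
    exact congrArg φ (Subtype.ext (by simp))
  | insert a s ha ih =>
    have h' : (∑ i ∈ s, f i)ᵀ = ∑ i ∈ s, f i := by
      rw [transpose_sum]; exact Finset.sum_congr rfl fun i _ => hs i
    have e : up (∑ i ∈ insert a s, f i) h = up (f a) (hs a) * up _ h' := by
      rw [up_mul_up]
      exact Subtype.ext (by simp [Finset.sum_insert ha])
    rw [e, map_mul, hf a (Finset.mem_insert_self _ _),
      ih (fun i hi => hf i (Finset.mem_insert_of_mem hi)), one_mul]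

theorem map_up_eq_one (hg : 3 ≤ g) (hφ : CentralOn φ (cong g N)) {B : Matrix (Fin g) (Fin g) ℤ}
    (h : Bᵀ = B) (hB : ∀ i j, (N : ℤ) ∣ B i j) : φ (up B h) = 1 := by
  let f : Fin g × Fin g → Matrix (Fin g) (Fin g) ℤ := fun p =>
    if p.1 < p.2 then single p.1 p.2 (B p.1 p.2) + single p.2 p.1 (B p.1 p.2)
    else if p.1 = p.2 then single p.1 p.1 (B p.1 p.1) else 0
  have hs : ∀ p, (f p)ᵀ = f p := by
    intro p
    simp only [f]
    split_ifs <;> simp [add_comm]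
  have hf : ∀ p ∈ Finset.univ, φ (up (f p) (hs p)) = 1 := by
    rintro p -
    by_cases h1 : p.1 < p.2
    · have e : f p = single p.1 p.2 (B p.1 p.2) + single p.2 p.1 (B p.1 p.2) := by simp [f, h1]
      have e2 : up (f p) (hs p) = up _ (e ▸ hs p) := Subtype.ext (by simp [e])
      rw [e2]
      exact map_up_offDiag hg hφ (hB _ _) _
    · by_cases h2 : p.1 = p.2
      · have e : f p = single p.1 p.1 (B p.1 p.1) := by simp [f, h2]
        have e2 : up (f p) (hs p) = up _ (e ▸ hs p) := Subtype.ext (by simp [e])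
        rw [e2]
        exact map_up_diag hg hφ _ (hB _ _) _
      · rw [← map_one φ]
        exact congrArg φ (Subtype.ext (by simp [f, h1, h2]))
  have e : ∑ p, f p = B := by
    let U : Matrix (Fin g) (Fin g) ℤ := of fun i j => if i ≤ j then B i j else 0
    let U' : Matrix (Fin g) (Fin g) ℤ := of fun i j => if i < j then B i j else 0
    have e1 : ∀ p : Fin g × Fin g, f p = single p.1 p.2 (U p.1 p.2) + (single p.1 p.2 (U' p.1 p.2))ᵀ := by
      rintro ⟨i, j⟩
      rcases lt_trichotomy i j with hij | hij | hij
      · simp [f, U, U', hij, hij.le]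
      · subst hij; simp [f, U, U']
      · simp [f, U, U', hij.not_gt, hij.ne', hij.not_ge]
    rw [Finset.sum_congr rfl fun p _ => e1 p, Finset.sum_add_distrib, ← transpose_sum,
      Fintype.sum_prod_type, Fintype.sum_prod_type]
    change ∑ i, ∑ j, single i j (U i j) + (∑ i, ∑ j, single i j (U' i j))ᵀ = B
    rw [← matrix_eq_sum_single, ← matrix_eq_sum_single]
    ext i j
    rcases lt_trichotomy i j with hij | hij | hij
    · simp [U, U', hij.le, hij.not_gt]
    · subst hij; simp [U, U']
    · have := congrFun (congrFun h i) j
      simp only [transpose_apply] at this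
      simp [U, U', hij.not_ge, hij, this]
  have e2 : up B h = up (∑ p, f p) (by rw [e, h]) := Subtype.ext (by simp [e])
  rw [e2]
  exact map_up_sum _ f hs hf _

theorem map_low_eq_one (hg : 3 ≤ g) (hφ : CentralOn φ (cong g N)) {B : Matrix (Fin g) (Fin g) ℤ}
    (h : Bᵀ = B) (hB : ∀ i j, (N : ℤ) ∣ B i j) : φ (low B h) = 1 := by
  have hn : (-B)ᵀ = -B := by rw [transpose_neg, h]
  have hd : ∀ i j, (N : ℤ) ∣ (-B) i j := fun i j => by simpa using hB i j
  have := hφ _ (up_mem_cong hn hd) (SymplecticGroup.symJ (Fin g) ℤ)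
  rw [symJ_mul_up, map_up_eq_one hg hφ hn hd] at this
  simpa using this

end kill

end Sp

/-! ### The `SL₂` of a hyperbolic plane in rank three. -/

namespace Sp
open SymbolSL2

variable {g : ℕ}

/-- The subgroup `SL₂` of the symplectic group acting on the `k`-th hyperbolic plane. -/
def long (k : Fin g) : SL(2, ℤ) →* Sp g ℤ where
  toFun M := ⟨fromBlocks (1 + single k k (M 0 0 - 1)) (single k k (M 0 1))
      (single k k (M 1 0)) (1 + single k k (M 1 1 - 1)), by
    have hd := det_eq M
    rw [SymplecticGroup.fromBlocks_mem_iff]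
    refine ⟨?_, ?_, ?_⟩
    · simp [add_mul, mul_add, mul_comm]
    · simp [add_mul, mul_add, mul_comm]
    · simp only [transpose_add, transpose_one, transpose_single, add_mul, mul_add, one_mul, mul_one,
        single_mul_single_same]
      ext i j
      simp only [Matrix.add_apply, Matrix.sub_apply, single_apply]
      split_ifs
      · linear_combination hd
      · ring⟩
  map_one' := Subtype.ext (by simp)
  map_mul' M M' := Subtype.ext (by
    simp only [Submonoid.coe_mul, fromBlocks_multiply, add_mul, mul_add, one_mul, mul_one,
        single_mul_single_same, Matrix.SpecialLinearGroup.coe_mul, Matrix.mul_apply,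
        Fin.sum_univ_two]
    congr 1 <;>
    · ext i j
      simp only [Matrix.add_apply, single_apply]
      split_ifs <;> ring)

@[simp] theorem coe_long (k : Fin g) (M : SL(2, ℤ)) :
    (long k M).1 = fromBlocks (1 + single k k (M 0 0 - 1)) (single k k (M 0 1))
      (single k k (M 1 0)) (1 + single k k (M 1 1 - 1)) := rfl

theorem long_mem_cong {N : ℕ} (k : Fin g) {M : SL(2, ℤ)} (hM : M ∈ CongruenceSubgroup.Gamma N) :
    long k M ∈ cong g N := by
  rw [mem_Gamma_iff] at hM
  rw [mem_cong_iff, ← fromBlocks_one]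
  rintro (p | p) (q | q) <;> simp [single_apply] <;> split_ifs <;> simp [hM]

/-- The Levi subgroup `SL_g`. -/
def leviSL : Matrix.SpecialLinearGroup (Fin g) ℤ →* Sp g ℤ :=
  levi.comp Matrix.SpecialLinearGroup.toGL

theorem leviSL_mem_cong {N : ℕ} {A : Matrix.SpecialLinearGroup (Fin g) ℤ} (hA : A ∈ slCong g N) :
    leviSL A ∈ cong g N :=
  levi_mem_cong (mem_slCong_iff.1 hA) (by
    have := mem_slCong_iff.1 (inv_mem hA)
    rw [← map_inv]
    exact this)

theorem coe_leviSL (A : Matrix.SpecialLinearGroup (Fin g) ℤ) :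
    (leviSL A).1 = fromBlocks A.1 0 0 A.1.adjugateᵀ := by
  rw [leviSL, MonoidHom.comp_apply, coe_levi, ← map_inv]
  rfl

theorem transpose_fin_three (a b c d e f g h i : ℤ) :
    (!![a, b, c; d, e, f; g, h, i])ᵀ = !![a, d, g; b, e, h; c, f, i] := by
  ext i j
  fin_cases i <;> fin_cases j <;> rfl

section rank_three

open SymbolSL3

variable {Q : Type*} [Group Q] {n N : ℕ} {φ : Sp 3 ℤ →* Q}

/-- The value of `φ` is determined, up to congruence matrices, by the upper half of a matrix. -/
theorem map_eq_of_top_eq (hg : 3 ≤ g) {φ : Sp g ℤ →* Q} (hφ : CentralOn φ (cong g N)) {X Y : Sp g ℤ}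
    (hX : X ∈ cong g N) (hY : Y ∈ cong g N) (h : ∀ i q, X.1 (Sum.inl i) q = Y.1 (Sum.inl i) q) :
    φ X = φ Y := by
  have hZ : X * Y⁻¹ ∈ cong g N := mul_mem hX (inv_mem hY)
  have htop : ∀ i q, (X * Y⁻¹).1 (Sum.inl i) q =
      (1 : Matrix (Fin g ⊕ Fin g) (Fin g ⊕ Fin g) ℤ) (Sum.inl i) q := by
    intro i q
    have e : (1 : Matrix (Fin g ⊕ Fin g) (Fin g ⊕ Fin g) ℤ) = (Y * Y⁻¹).1 := by simp
    rw [e, Submonoid.coe_mul, Submonoid.coe_mul, Matrix.mul_apply, Matrix.mul_apply]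
    exact Finset.sum_congr rfl fun k _ => by rw [h]
  rw [← mul_inv_eq_one, ← map_inv, ← map_mul]
  generalize X * Y⁻¹ = Z at hZ htop
  obtain ⟨Z, hZm⟩ := Z
  obtain ⟨A, B, C, D, rfl⟩ : ∃ A B C D, Z = fromBlocks A B C D :=
    ⟨_, _, _, _, (fromBlocks_toBlocks Z).symm⟩
  have hA : A = 1 := by
    ext i j
    simpa [Matrix.one_apply] using htop i (Sum.inl j)
  have hB : B = 0 := by
    ext i j
    simpa using htop i (Sum.inr j)
  subst hA hB
  obtain ⟨h1, -, h3⟩ := SymplecticGroup.fromBlocks_mem_iff.1 hZm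
  have hD : D = 1 := by simpa using h3
  subst hD
  have hC : Cᵀ = C := by simpa using h1.symm
  refine map_low_eq_one hg hφ hC fun i j => ?_
  have := mem_cong_iff.1 hZ (Sum.inr i) (Sum.inl j)
  simpa using this

theorem map_leviSL_corner (hn : 1 ≤ n) (hφ : CentralOn φ (cong 3 (2 ^ n))) {M : SL(2, ℤ)}
    (hM : M ∈ CongruenceSubgroup.Gamma (2 ^ n)) : φ (leviSL (corner M)) = 1 :=
  map_corner_eq_one (φ := φ.comp leviSL) hn (hφ.comp _ fun _ h => leviSL_mem_cong h) hM

theorem coe_long_zero (M : SL(2, ℤ)) : (long (0 : Fin 3) M).1 =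
    fromBlocks !![M 0 0, 0, 0; 0, 1, 0; 0, 0, 1] !![M 0 1, 0, 0; 0, 0, 0; 0, 0, 0]
      !![M 1 0, 0, 0; 0, 0, 0; 0, 0, 0] !![M 1 1, 0, 0; 0, 1, 0; 0, 0, 1] := by
  rw [coe_long]
  congr 1 <;>
  · ext i j
    fin_cases i <;> fin_cases j <;> simp

theorem coe_long_one (M : SL(2, ℤ)) : (long (1 : Fin 3) M).1 =
    fromBlocks !![1, 0, 0; 0, M 0 0, 0; 0, 0, 1] !![0, 0, 0; 0, M 0 1, 0; 0, 0, 0]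
      !![0, 0, 0; 0, M 1 0, 0; 0, 0, 0] !![1, 0, 0; 0, M 1 1, 0; 0, 0, 1] := by
  rw [coe_long]
  congr 1 <;>
  · ext i j
    fin_cases i <;> fin_cases j <;> simp

/-- A signed permutation in the Levi subgroup exchanges the first two hyperbolic planes, and
centrality ignores this conjugation. -/
theorem map_long_one (hφ : CentralOn φ (cong 3 N)) {M : SL(2, ℤ)}
    (hM : M ∈ CongruenceSubgroup.Gamma N) : φ (long 1 M) = φ (long 0 M) := by
  let P : Matrix.SpecialLinearGroup (Fin 3) ℤ :=
    ⟨!![0, 1, 0; 1, 0, 0; 0, 0, -1], by simp [det_fin_three]⟩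
  have hP : P.1 = !![0, 1, 0; 1, 0, 0; 0, 0, -1] := rfl
  rw [← hφ _ (long_mem_cong 0 hM) (leviSL P)]
  refine congrArg φ (eq_mul_inv_of_mul_eq (Subtype.ext ?_))
  simp only [Submonoid.coe_mul, coe_leviSL, coe_long_zero, coe_long_one, fromBlocks_multiply, hP,
    adjugate_fin_three, transpose_fin_three]
  congr 1 <;>
  · ext i j
    fin_cases i <;> fin_cases j <;> simp

/-- Levi factors of level `2 ^ n`, killed by the `SL₃` result, move the entry `a` from plane `0` to
plane `1` and turn `b` into `b * e ^ 2`. Comparing upper halves suffices, as lower unipotents of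
level `2 ^ n` are killed too. -/
theorem map_long_sq (hn : 1 ≤ n) (hφ : CentralOn φ (cong 3 (2 ^ n))) {a b c₁ t₁ e c₂ t₂ c₃ t₃ : ℤ}
    {d₁ : a * t₁ - b * c₁ = 1} {d₂ : a * t₂ - e * c₂ = 1} {d₃ : a * t₃ - b * e ^ 2 * c₃ = 1}
    (h₁ : mk a b c₁ t₁ d₁ ∈ CongruenceSubgroup.Gamma (2 ^ n))
    (h₂ : mk a e c₂ t₂ d₂ ∈ CongruenceSubgroup.Gamma (2 ^ n))
    (h₃ : mk a (b * e ^ 2) c₃ t₃ d₃ ∈ CongruenceSubgroup.Gamma (2 ^ n)) :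
    φ (long 0 (mk a b c₁ t₁ d₁)) = φ (long 0 (mk a (b * e ^ 2) c₃ t₃ d₃)) := by
  have g₁ := mk_mem_Gamma_iff.1 h₁
  have g₂ := mk_mem_Gamma_iff.1 h₂
  have d₄ : t₂ * a - c₂ * e = 1 := by linear_combination d₂
  have h₄ : mk t₂ c₂ e a d₄ ∈ CongruenceSubgroup.Gamma (2 ^ n) :=
    mk_mem_Gamma_iff.2 ⟨g₂.2.2.2, g₂.2.2.1, g₂.2.1, g₂.1⟩
  rw [← map_long_one hφ h₃]
  let E : SL(2, ℤ) := lower (-e) * upper (-c₂)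
  have hE : E ∈ CongruenceSubgroup.Gamma (2 ^ n) :=
    mul_mem (lower_mem g₂.2.1.neg_right) (upper_mem g₂.2.2.1.neg_right)
  -- This symmetric matrix cancels the unwanted entries of the upper right block.
  let B : Matrix (Fin 3) (Fin 3) ℤ := !![-(b * a), b * e, 0; b * e, 0, 0; 0, 0, 0]
  have hB : Bᵀ = B := by
    ext i j; fin_cases i <;> fin_cases j <;> simp [B]
  have hBN : ∀ i j, ((2 ^ n : ℕ) : ℤ) ∣ B i j := by
    intro i j
    fin_cases i <;> fin_cases j <;> simp only [B] <;> simp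
    · exact g₁.2.1.mul_right a
    all_goals exact g₁.2.1.mul_right e
  have key : φ (leviSL (corner E) * long 0 (mk a b c₁ t₁ d₁) * leviSL (corner (mk t₂ c₂ e a d₄)) *
      up B hB) = φ (long 1 (mk a (b * e ^ 2) c₃ t₃ d₃)) := by
    refine map_eq_of_top_eq le_rfl hφ (mul_mem (mul_mem (mul_mem (leviSL_mem_cong (corner_mem hE))
      (long_mem_cong 0 h₁)) (leviSL_mem_cong (corner_mem h₄))) (up_mem_cong hB hBN))
      (long_mem_cong 1 h₃) ?_
    have hE0 : (corner E).1 = !![1, -c₂, 0; -e, 1 + e * c₂, 0; 0, 0, 1] := by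
      rw [coe_corner]
      simp [E, Matrix.mul_apply, Fin.sum_univ_two]
      ring
    have hE1 : (corner (mk t₂ c₂ e a d₄)).1 = !![t₂, c₂, 0; e, a, 0; 0, 0, 1] := rfl
    simp only [Submonoid.coe_mul, coe_leviSL, coe_long_zero, coe_long_one, coe_up,
      fromBlocks_multiply, hE0, hE1, adjugate_fin_three, transpose_fin_three, B]
    rintro i (q | q)
    · simp only [fromBlocks_apply₁₁]
      fin_cases i <;> fin_cases q <;> simp <;> grind
    · simp only [fromBlocks_apply₁₂]
      fin_cases i <;> fin_cases q <;> simp <;> grind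
  rw [map_mul, map_mul, map_mul, map_leviSL_corner hn hφ hE, map_leviSL_corner hn hφ h₄,
    map_up_eq_one le_rfl hφ hB hBN, one_mul, mul_one, mul_one] at key
  exact key

theorem long_upper (k : Fin g) (t : ℤ) : long k (upper t) = up (single k k t) (by simp) :=
  Subtype.ext (by simp)

theorem long_lower (k : Fin g) (t : ℤ) : long k (lower t) = low (single k k t) (by simp) :=
  Subtype.ext (by simp)

theorem map_long_zero_eq_one (hn : 1 ≤ n) (hφ : CentralOn φ (cong 3 (2 ^ n))) {M : SL(2, ℤ)}
    (hM : M ∈ CongruenceSubgroup.Gamma (2 ^ n)) : φ (long 0 M) = 1 := by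
  have hN : ((2 ^ n : ℕ) : ℤ) = 2 ^ n := by push_cast; rfl
  have hsd : ∀ t : ℤ, ((2 ^ n : ℕ) : ℤ) ∣ t →
      ∀ i j, ((2 ^ n : ℕ) : ℤ) ∣ single (0 : Fin 3) (0 : Fin 3) t i j := fun t ht i j => by
    rw [single_apply]; split_ifs; exacts [ht, dvd_zero _]
  have hl : ∀ t : ℤ, ((2 ^ n : ℕ) : ℤ) ∣ t → (φ.comp (long 0)) (lower t) = 1 := fun t ht => by
    rw [MonoidHom.comp_apply, long_lower]
    exact map_low_eq_one le_rfl hφ _ (hsd t ht)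
  have hu : ∀ t : ℤ, ((2 ^ n : ℕ) : ℤ) ∣ t → (φ.comp (long 0)) (upper t) = 1 := fun t ht => by
    rw [MonoidHom.comp_apply, long_upper]
    exact map_up_eq_one le_rfl hφ _ (hsd t ht)
  have hc : CentralOn (φ.comp (long 0)) (CongruenceSubgroup.Gamma (2 ^ n)) :=
    hφ.comp _ fun _ h => long_mem_cong 0 h
  have hsq : ∀ {a b e : ℤ}, ((2 ^ n : ℕ) : ℤ) ∣ a - 1 → ((2 ^ n : ℕ) : ℤ) ∣ b →
      ((2 ^ n : ℕ) : ℤ) ∣ e → IsCoprime a b → IsCoprime a e →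
      symbol (φ.comp (long 0)) (2 ^ n) a (b * e ^ 2) = symbol (φ.comp (long 0)) (2 ^ n) a b := by
    intro a b e ha hb he hab hae
    obtain ⟨c₁, t₁, d₁, h₁, -⟩ := exists_mk_mem_Gamma ha hb hab
    obtain ⟨c₂, t₂, d₂, h₂, -⟩ := exists_mk_mem_Gamma ha he hae
    obtain ⟨c₃, t₃, d₃, h₃, -⟩ := exists_mk_mem_Gamma ha (hb.mul_right (e ^ 2))
      (hab.mul_right (hae.pow_right (n := 2)))
    rw [← map_mk_eq_symbol hl h₁, ← map_mk_eq_symbol hl h₃]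
    exact (map_long_sq hn hφ h₁ h₂ h₃).symm
  have dm : ∀ x : ℤ, ((2 ^ n : ℕ) : ℤ) ∣ 2 ^ n * x := fun x => by rw [hN]; exact dvd_mul_right _ _
  have dvd_of : ∀ {a : ℤ}, a ≡ 1 [ZMOD 2 ^ n] → ((2 ^ n : ℕ) : ℤ) ∣ a - 1 := fun {a} h => by
    rw [hN]; exact Int.modEq_iff_dvd.1 h.symm
  have hm := mem_Gamma_iff.1 hM
  have hd := det_eq M
  obtain ⟨x, hx⟩ := hm.2.1
  rw [hN] at hx
  have ha : M 0 0 ≡ 1 [ZMOD 2 ^ n] := by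
    have := hm.1
    rw [hN] at this
    exact (Int.modEq_iff_dvd.2 this).symm
  have hxa : IsCoprime x (M 0 0) := ⟨-(2 ^ n * M 1 0), M 1 1, by
    rw [hx] at hd
    linear_combination hd⟩
  rw [← MonoidHom.comp_apply, map_eq_symbol hl hM, hx]
  generalize M 0 0 = a at ha hxa
  obtain ⟨y, l, -, hxy, hlp, hl2, hya, hal, hl1, hl4, hyl⟩ := exists_odd_and_neg_prime hn ha hxa
  have hlo : IsCoprime (2 ^ n : ℤ) l := by
    refine IsCoprime.pow_left ?_
    rw [show (2 : ℤ) = ((2 : ℕ) : ℤ) from rfl, Nat.isCoprime_iff_coprime]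
    exact (Nat.coprime_primes Nat.prime_two hlp).2 hl2.ne
  -- The factor `2 ^ n` inside the square is what allows `hsq` to be applied with `e = 2 ^ n * w`, a
  -- multiple of the level.
  obtain ⟨w, hw, hyw⟩ := exists_modEq_sq_or_neg_sq hlp hl4 hlo hyl
  have e1 : symbol (φ.comp (long 0)) (2 ^ n) a (2 ^ n * x) =
      symbol (φ.comp (long 0)) (2 ^ n) a (2 ^ n * y) := by
    obtain ⟨t, ht⟩ := Int.modEq_iff_dvd.1 hxy
    refine (symbol_congr_right hl hu (dvd_of ha) (dm _) (isCoprime_pow_mul ha hxa) ⟨t, ?_⟩).symm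
    rw [hN]
    linear_combination 2 ^ n * ht
  have e2 : symbol (φ.comp (long 0)) (2 ^ n) a (2 ^ n * y) =
      symbol (φ.comp (long 0)) (2 ^ n) (-l) (2 ^ n * y) :=
    (symbol_congr_left hl hc (dvd_of ha) (dm _) (isCoprime_pow_mul ha hya)
      (Int.modEq_iff_dvd.1 hal)).symm
  have hcop : IsCoprime (-(l : ℤ)) (2 ^ n) := hlo.symm.neg_left
  have e3 : ∀ s : ℤ, s ∣ 1 → y ≡ s * (2 ^ n * w) ^ 2 [ZMOD l] →
      symbol (φ.comp (long 0)) (2 ^ n) (-l) (2 ^ n * y) = 1 := by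
    intro s hs hy
    have hcs : IsCoprime (-(l : ℤ)) (2 ^ n * s) :=
      hcop.mul_right (isCoprime_one_right.of_isCoprime_of_dvd_right hs)
    have hcw : IsCoprime (-(l : ℤ)) (2 ^ n * w) := hcop.mul_right hw.symm.neg_left
    have : symbol (φ.comp (long 0)) (2 ^ n) (-l) (2 ^ n * y) =
        symbol (φ.comp (long 0)) (2 ^ n) (-l) ((2 ^ n * s) * (2 ^ n * w) ^ 2) := by
      obtain ⟨t, ht⟩ := Int.modEq_iff_dvd.1 hy
      refine (symbol_congr_right hl hu (dvd_of hl1) (dm _)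
        (isCoprime_pow_mul hl1 hyl.neg_right) ⟨-t, ?_⟩).symm
      rw [hN]
      linear_combination 2 ^ n * ht
    rw [this, hsq (dvd_of hl1) (dm _) (dm _) hcs hcw]
    refine symbol_eq_one_of_dvd hl hu hc (dm _) ?_
    have hs' : (2 ^ n * s : ℤ) ∣ 2 ^ n := by
      simpa using mul_dvd_mul_left (2 ^ n : ℤ) hs
    exact hs'.trans (Int.modEq_iff_dvd.1 hl1.symm)
  rw [e1, e2]
  rcases hyw with h | h
  · exact e3 1 (one_dvd _) (by simpa using h)
  · exact e3 (-1) (by norm_num) (by simpa using h)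

end rank_three

end Sp

/-! ### Passage from rank three to rank `g`. -/

namespace Sp
open SymbolSL2

variable {g m : ℕ}

/-- The coordinate inclusion `ℤ^m → ℤ^g` given by an embedding of the index sets. -/
def coordIncl (e : Fin m ↪ Fin g) : Matrix (Fin g) (Fin m) ℤ := of fun i j => if i = e j then 1 else 0

theorem transpose_coordIncl_mul (e : Fin m ↪ Fin g) : (coordIncl e)ᵀ * coordIncl e = 1 := by
  ext i j
  simp [Matrix.mul_apply, coordIncl, Matrix.one_apply, eq_comm]

theorem coordIncl_mul_single_mul (e : Fin m ↪ Fin g) (i j : Fin m) (t : ℤ) :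
    coordIncl e * single i j t * (coordIncl e)ᵀ = single (e i) (e j) t := by
  ext p q
  simp only [Matrix.mul_apply, coordIncl, single_apply, of_apply, transpose_apply]
  rw [Finset.sum_eq_single j, Finset.sum_eq_single i]
  · by_cases hp : p = e i <;> by_cases hq : q = e j <;> simp [hp, hq, eq_comm]
  · intro b _ hb; simp [hb.symm]
  · simp
  · intro b _ hb; simp [hb.symm]
  · simp

/-- The doubled coordinate inclusion, compatible with the symplectic forms. -/
def incl (e : Fin m ↪ Fin g) : Matrix (Fin g ⊕ Fin g) (Fin m ⊕ Fin m) ℤ :=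
  fromBlocks (coordIncl e) 0 0 (coordIncl e)

theorem transpose_incl_mul (e : Fin m ↪ Fin g) : (incl e)ᵀ * incl e = 1 := by
  simp [incl, fromBlocks_transpose, fromBlocks_multiply, transpose_coordIncl_mul]

theorem J_mul_incl (e : Fin m ↪ Fin g) : J (Fin g) ℤ * incl e = incl e * J (Fin m) ℤ := by
  simp [incl, J, fromBlocks_multiply]

theorem transpose_incl_mul_J (e : Fin m ↪ Fin g) :
    (incl e)ᵀ * J (Fin g) ℤ = J (Fin m) ℤ * (incl e)ᵀ := by
  simp [incl, J, fromBlocks_transpose, fromBlocks_multiply]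

/-- With `Pᵀ * P = 1` this is the multiplicativity of `X ↦ 1 + P (X - 1) Pᵀ`, which underlies
`embed`. -/
theorem one_add_conj_mul {ι κ : Type*} [Fintype ι] [Fintype κ] [DecidableEq ι] [DecidableEq κ]
    {P : Matrix ι κ ℤ} (hP : Pᵀ * P = 1) (Y Z : Matrix κ κ ℤ) :
    (1 + P * Y * Pᵀ) * (1 + P * Z * Pᵀ) = 1 + P * (Y + Z + Y * Z) * Pᵀ := by
  have h : ∀ W : Matrix κ ι ℤ, Pᵀ * (P * W) = W := fun W => by
    rw [← Matrix.mul_assoc, hP, Matrix.one_mul]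
  simp only [Matrix.mul_add, Matrix.add_mul, Matrix.mul_assoc, Matrix.one_mul, Matrix.mul_one, h]
  abel

/-- The inclusion of symplectic groups induced by an embedding of the index sets. -/
def embed (e : Fin m ↪ Fin g) : Sp m ℤ →* Sp g ℤ where
  toFun X := ⟨1 + incl e * (X.1 - 1) * (incl e)ᵀ, by
    have hX := SymplecticGroup.mem_iff.1 X.2
    rw [SymplecticGroup.mem_iff]
    have h1 : J (Fin g) ℤ * (1 + incl e * (X.1 - 1) * (incl e)ᵀ)ᵀ =
        (1 + incl e * (J (Fin m) ℤ * X.1ᵀ * (J (Fin m) ℤ)⁻¹ - 1) * (incl e)ᵀ) * J (Fin g) ℤ := by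
      have hJ : J (Fin m) ℤ * (J (Fin m) ℤ)⁻¹ = 1 := Matrix.mul_nonsing_inv _ (isUnit_det_J _ _)
      have hJ' : (J (Fin m) ℤ)⁻¹ * J (Fin m) ℤ = 1 := Matrix.nonsing_inv_mul _ (isUnit_det_J _ _)
      simp only [transpose_add, transpose_one, transpose_mul, transpose_transpose, transpose_sub,
        Matrix.mul_add, Matrix.add_mul, Matrix.one_mul, Matrix.mul_one]
      rw [Matrix.mul_assoc _ (incl e)ᵀ, transpose_incl_mul_J, ← Matrix.mul_assoc (J _ _),
        J_mul_incl]
      simp only [Matrix.mul_assoc, Matrix.sub_mul, Matrix.mul_sub, Matrix.one_mul]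
      rw [← Matrix.mul_assoc (J (Fin m) ℤ)⁻¹, hJ', Matrix.one_mul]
    have hJ : J (Fin m) ℤ * (J (Fin m) ℤ)⁻¹ = 1 := Matrix.mul_nonsing_inv _ (isUnit_det_J _ _)
    rw [mul_assoc, h1, ← mul_assoc, one_add_conj_mul (transpose_incl_mul e)]
    have h2 : X.1 * (J (Fin m) ℤ * X.1ᵀ * (J (Fin m) ℤ)⁻¹) = 1 := by
      rw [← mul_assoc, ← mul_assoc, hX, hJ]
    have h3 : ∀ Y : Matrix (Fin m ⊕ Fin m) (Fin m ⊕ Fin m) ℤ, X.1 * Y = 1 →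
        X.1 - 1 + (Y - 1) + (X.1 - 1) * (Y - 1) = 0 := by
      intro Y hY
      calc _ = X.1 * Y - 1 := by noncomm_ring
        _ = 0 := by rw [hY, sub_self]
    rw [h3 _ h2]
    simp⟩
  map_one' := Subtype.ext (by simp)
  map_mul' X Y := Subtype.ext (by
    simp only [Submonoid.coe_mul]
    rw [one_add_conj_mul (transpose_incl_mul e)]
    congr 3
    noncomm_ring)

theorem coe_embed (e : Fin m ↪ Fin g) (X : Sp m ℤ) :
    (embed e X).1 = 1 + incl e * (X.1 - 1) * (incl e)ᵀ := rfl

theorem embed_mem_cong {N : ℕ} (e : Fin m ↪ Fin g) {X : Sp m ℤ} (hX : X ∈ cong m N) :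
    embed e X ∈ cong g N := by
  rw [mem_cong_iff] at hX ⊢
  intro p q
  rw [coe_embed, Matrix.add_apply, add_sub_cancel_left, Matrix.mul_apply]
  refine Finset.dvd_sum fun i _ => Dvd.dvd.mul_right ?_ _
  rw [Matrix.mul_apply]
  exact Finset.dvd_sum fun j _ => (hX j i).mul_left _

theorem embed_long (e : Fin m ↪ Fin g) (k : Fin m) (M : SL(2, ℤ)) :
    embed e (long k M) = long (e k) M := by
  refine Subtype.ext ?_
  rw [coe_embed, coe_long, coe_long, incl, ← fromBlocks_one, ← fromBlocks_one,
    sub_eq_add_neg, fromBlocks_neg, fromBlocks_add, fromBlocks_transpose, fromBlocks_multiply, fromBlocks_multiply, fromBlocks_add]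
  simp [coordIncl_mul_single_mul]

theorem map_long_eq_one {Q : Type*} [Group Q] {n : ℕ} {φ : Sp g ℤ →* Q} (hg : 3 ≤ g) (hn : 1 ≤ n)
    (hφ : CentralOn φ (cong g (2 ^ n))) (k : Fin g) {M : SL(2, ℤ)}
    (hM : M ∈ CongruenceSubgroup.Gamma (2 ^ n)) : φ (long k M) = 1 := by
  obtain ⟨i, hik, -⟩ := exists_ne_ne hg k k
  obtain ⟨j, hjk, hji⟩ := exists_ne_ne hg k i
  let e : Fin 3 ↪ Fin g := ⟨![k, i, j], by
    intro a b hab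
    fin_cases a <;> fin_cases b <;> simp_all [eq_comm]⟩
  have : long k M = embed e (long 0 M) := (embed_long e 0 M).symm
  rw [this]
  exact map_long_zero_eq_one (φ := φ.comp (embed e)) hn
    (hφ.comp _ fun _ h => embed_mem_cong e h) hM

end Sp

/-! ### Column reduction and generation of congruence subgroups. -/

namespace Sp

variable {g : ℕ} {R : Type} [CommRing R]

section action

/-- The basis vector `e_i`. -/
def basisE (R : Type) [CommRing R] (i : Fin g) : Fin g ⊕ Fin g → R := Sum.elim (Pi.single i 1) 0

/-- The basis vector `f_i`. -/
def basisF (R : Type) [CommRing R] (i : Fin g) : Fin g ⊕ Fin g → R := Sum.elim 0 (Pi.single i 1)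

theorem form_mulVec (X : Sp g R) (v w : Fin g ⊕ Fin g → R) :
    (X.1 *ᵥ v) ⬝ᵥ (J (Fin g) R *ᵥ (X.1 *ᵥ w)) = v ⬝ᵥ (J (Fin g) R *ᵥ w) := by
  rw [← vecMul_transpose, ← dotProduct_mulVec, mulVec_mulVec, mulVec_mulVec,
    SymplecticGroup.mem_iff'.1 X.2]

theorem form_elim (a c a' c' : Fin g → R) :
    Sum.elim a c ⬝ᵥ (J (Fin g) R *ᵥ Sum.elim a' c') = c ⬝ᵥ a' - a ⬝ᵥ c' := by
  simp [J, fromBlocks_mulVec, sumElim_dotProduct_sumElim, neg_mulVec]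
  ring

theorem up_mulVec {B : Matrix (Fin g) (Fin g) R} (h : Bᵀ = B) (a c : Fin g → R) :
    (up B h).1 *ᵥ Sum.elim a c = Sum.elim (a + B *ᵥ c) c := by
  simp [fromBlocks_mulVec]

theorem low_mulVec {C : Matrix (Fin g) (Fin g) R} (h : Cᵀ = C) (a c : Fin g → R) :
    (low C h).1 *ᵥ Sum.elim a c = Sum.elim a (C *ᵥ a + c) := by
  simp [fromBlocks_mulVec]

theorem levi_colUnit_mulVec (k : Fin g) {y : Fin g → R} (hy : y k = 0) (a c : Fin g → R) :
    (levi (colUnit k y hy)).1 *ᵥ Sum.elim a c =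
      Sum.elim (a + a k • y) (c - (y ⬝ᵥ c) • Pi.single k 1) := by
  rw [coe_levi, coe_inv_colUnit, coe_colUnit]
  simp [fromBlocks_mulVec, add_mulVec, sub_mulVec, vecMulVec_mulVec, transpose_vecMulVec]

theorem mulVec_basisE (X : Matrix (Fin g ⊕ Fin g) (Fin g ⊕ Fin g) R) (i : Fin g)
    (p : Fin g ⊕ Fin g) : (X *ᵥ basisE R i) p = X p (Sum.inl i) := by
  have : basisE R i = Pi.single (Sum.inl i) 1 := by
    ext (q | q) <;> simp [basisE, Pi.single_apply]
  simp [this]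

/-- The matrix fixes the basis vectors `e_i` for `i < k`. -/
def FixesBelow (k : ℕ) (X : Sp g R) : Prop :=
  ∀ i : Fin g, i.1 < k → X.1 *ᵥ basisE R i = basisE R i

theorem FixesBelow.mul {k : ℕ} {X Y : Sp g R} (hX : FixesBelow k X) (hY : FixesBelow k Y) :
    FixesBelow k (X * Y) := fun i hi => by
  rw [Submonoid.coe_mul, ← mulVec_mulVec, hY i hi, hX i hi]

/-- Up to sign, the `f_i` coordinate is the pairing with `e_i`; `X` preserves the form and fixes
`e_i`. -/
theorem FixesBelow.eq_zero {k : ℕ} {X : Sp g R} (hX : FixesBelow k X) {v : Fin g ⊕ Fin g → R}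
    {i : Fin g} (hi : i.1 < k) (hv : v (Sum.inr i) = 0) : (X.1 *ᵥ v) (Sum.inr i) = 0 := by
  have h := form_mulVec X (basisE R i) v
  rw [hX i hi, basisE, ← Sum.elim_comp_inl_inr (X.1 *ᵥ v), ← Sum.elim_comp_inl_inr v, form_elim,
    form_elim] at h
  simpa [hv] using h

theorem fixesBelow_up (k : ℕ) {B : Matrix (Fin g) (Fin g) R} (h : Bᵀ = B) :
    FixesBelow k (up B h) := fun i _ => by
  rw [basisE, up_mulVec, mulVec_zero, add_zero]

theorem fixesBelow_low {k : ℕ} {C : Matrix (Fin g) (Fin g) R} (h : Cᵀ = C)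
    (hC : ∀ i : Fin g, i.1 < k → C *ᵥ Pi.single i 1 = 0) :
    FixesBelow k (low C h) := fun i hi => by
  rw [basisE, low_mulVec, hC i hi, zero_add]

theorem fixesBelow_levi_colUnit (k : Fin g) {y : Fin g → R} (hy : y k = 0) :
    FixesBelow k.1 (levi (colUnit k y hy)) := fun i hi => by
  have : i ≠ k := by rintro rfl; exact lt_irrefl _ hi
  rw [basisE, levi_colUnit_mulVec]
  simp [this.symm]

end action

/-- A subgroup containing the elementary matrices of level `L`. -/
structure ContainsElementary (L : R) (H : Subgroup (Sp g R)) : Prop where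
  up_mem : ∀ (B : Matrix (Fin g) (Fin g) R) (h : Bᵀ = B), (∀ i j, L ∣ B i j) → up B h ∈ H
  low_mem : ∀ (B : Matrix (Fin g) (Fin g) R) (h : Bᵀ = B), (∀ i j, L ∣ B i j) → low B h ∈ H
  levi_mem : ∀ (k : Fin g) (y : Fin g → R) (hy : y k = 0), (∀ i, L ∣ y i) →
    levi (colUnit k y hy) ∈ H

theorem isSymm_cross (k : Fin g) (c : Fin g → R) (s : R) :
    (vecMulVec c (Pi.single k 1) + vecMulVec (Pi.single k 1) c + single k k s)ᵀ =
      vecMulVec c (Pi.single k 1) + vecMulVec (Pi.single k 1) c + single k k s := by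
  simp [transpose_vecMulVec, add_comm]

theorem dvd_cross {L : R} (k : Fin g) {c : Fin g → R} {s : R} (hc : ∀ i, L ∣ c i) (hs : L ∣ s)
    (i j : Fin g) : L ∣ (vecMulVec c (Pi.single k 1) + vecMulVec (Pi.single k 1) c +
      single k k s) i j := by
  simp only [Matrix.add_apply, vecMulVec_apply, single_apply]
  refine dvd_add (dvd_add ((hc i).mul_right _) ((hc j).mul_left _)) ?_
  split_ifs
  exacts [hs, dvd_zero _]

theorem cross_mulVec (k : Fin g) (c : Fin g → R) (s : R) (a : Fin g → R) :
    (vecMulVec c (Pi.single k 1) + vecMulVec (Pi.single k 1) c + single k k s) *ᵥ a =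
      a k • c + (c ⬝ᵥ a + s * a k) • Pi.single k 1 := by
  ext i
  by_cases h : i = k
  · subst h
    simp [add_mulVec, vecMulVec_mulVec, single_mulVec]
    ring
  · simp [add_mulVec, vecMulVec_mulVec, single_mulVec, h]

theorem cross_mulVec_single {k : Fin g} {c : Fin g → R} {s : R} {i : Fin g} (hi : i < k)
    (hc : c i = 0) :
    (vecMulVec c (Pi.single k 1) + vecMulVec (Pi.single k 1) c + single k k s) *ᵥ
      (Pi.single i 1) = 0 := by
  rw [cross_mulVec]
  simp [hi.ne', hc]

/-- Column reduction: a subgroup containing the elementary matrices which can normalise one diagonal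
entry at a time is everything. -/
theorem le_of_normalizes {L : R} {Γ H : Subgroup (Sp g R)} (hHΓ : H ≤ Γ)
    (hΓ : ∀ X ∈ Γ, ∀ p q, L ∣ X.1 p q - (1 : Matrix (Fin g ⊕ Fin g) (Fin g ⊕ Fin g) R) p q)
    (hH : ContainsElementary L H)
    (hstep : ∀ k : Fin g, ∀ X ∈ Γ, FixesBelow k.1 X → ∃ h ∈ H, FixesBelow k.1 h ∧
      ((h * X).1 *ᵥ basisE R k) (Sum.inl k) = 1) : Γ ≤ H := by
  have main : ∀ j k : ℕ, k + j = g → ∀ X ∈ Γ, FixesBelow k X → X ∈ H := by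
    intro j
    induction j with
    | zero =>
      rintro k rfl X hXΓ hX
      obtain ⟨X, hXm⟩ := X
      obtain ⟨A, B, C, D, rfl⟩ : ∃ A B C D, X = fromBlocks A B C D :=
        ⟨_, _, _, _, (fromBlocks_toBlocks X).symm⟩
      have hcol : ∀ i p, fromBlocks A B C D p (Sum.inl i) = basisE R i p := fun i p => by
        rw [← mulVec_basisE (fromBlocks A B C D)]
        exact congrFun (hX i i.2) p
      have hA : A = 1 := by
        ext p i
        have := hcol i (Sum.inl p)
        simpa [basisE, Pi.single_apply, Matrix.one_apply] using this
      have hC : C = 0 := by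
        ext p i
        have := hcol i (Sum.inr p)
        simpa [basisE] using this
      subst hA hC
      obtain ⟨-, h2, h3⟩ := SymplecticGroup.fromBlocks_mem_iff.1 hXm
      have hD : D = 1 := by simpa using h3
      subst hD
      have hB : Bᵀ = B := by simpa using h2
      refine hH.up_mem B hB fun i j => ?_
      simpa using hΓ _ hXΓ (Sum.inl i) (Sum.inr j)
    | succ j ih =>
      intro k hk X hX hfix
      have hkg : k < g := by omega
      obtain ⟨h, hh, hhfix, h1⟩ := hstep ⟨k, hkg⟩ X hX hfix
      rw [← Subgroup.mul_mem_cancel_left H hh]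
      have hY : h * X ∈ Γ := mul_mem (hHΓ hh) hX
      have hYfix : FixesBelow k (h * X) := hhfix.mul hfix
      generalize h * X = Y at hY hYfix h1
      set k' : Fin g := ⟨k, hkg⟩ with hk'
      obtain ⟨a, c, hac⟩ : ∃ a c, Y.1 *ᵥ basisE R k' = Sum.elim a c :=
        ⟨_, _, (Sum.elim_comp_inl_inr _).symm⟩
      have hak : a k' = 1 := by simpa [hac] using h1
      have hc0 : ∀ i : Fin g, i.1 < k → c i = 0 := fun i hi => by
        have := hYfix.eq_zero (v := basisE R k') hi (by simp [basisE])
        simpa [hac] using this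
      have hcL : ∀ i, L ∣ c i := fun i => by
        have := hΓ Y hY (Sum.inr i) (Sum.inl k')
        rw [← mulVec_basisE Y.1, hac] at this
        simpa using this
      have haL : ∀ i, L ∣ (Pi.single k' 1 - a : Fin g → R) i := fun i => by
        have := hΓ Y hY (Sum.inl i) (Sum.inl k')
        rw [← mulVec_basisE Y.1, hac, dvd_sub_comm] at this
        simpa [Matrix.one_apply, Pi.single_apply] using this
      have hcL' : ∀ i, L ∣ (-c) i := fun i => by simpa using hcL i
      -- Since `a k' = 1`, the corner entry `c ⬝ᵥ a` makes this symmetric matrix send `a` to exactly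
      -- `-c`, so the lower half of the column is cleared. The Levi matrix below then clears the
      -- upper half.
      have hlow := hH.low_mem _ (isSymm_cross k' (-c) (c ⬝ᵥ a))
        (dvd_cross k' hcL' (Finset.dvd_sum fun i _ => (hcL i).mul_right _))
      have hy : (Pi.single k' 1 - a : Fin g → R) k' = 0 := by simp [hak]
      have hlevi := hH.levi_mem k' _ hy haL
      rw [← Subgroup.mul_mem_cancel_left H hlow, ← Subgroup.mul_mem_cancel_left H hlevi]
      refine ih (k + 1) (by omega) _ (mul_mem (hHΓ hlevi) (mul_mem (hHΓ hlow) hY)) ?_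
      intro i hi
      rcases Nat.lt_succ_iff_lt_or_eq.1 hi with hi | hi
      · refine ((fixesBelow_levi_colUnit k' hy).mul ((fixesBelow_low _ fun i hi => ?_).mul hYfix)) i hi
        exact cross_mulVec_single hi (by simp [hc0 i hi])
      · obtain rfl : i = k' := Fin.ext hi
        rw [Submonoid.coe_mul, Submonoid.coe_mul, ← mulVec_mulVec, ← mulVec_mulVec, hac, low_mulVec,
          cross_mulVec, levi_colUnit_mulVec, basisE]
        simp [hak]
  intro X hX
  exact main g 0 (by omega) X hX fun i hi => absurd hi (by omega)

/-- Two elementary matrices add to the `k`-th lower coordinate a combination of the later ones. -/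
theorem ContainsElementary.exists_shift {L : R} {H : Subgroup (Sp g R)}
    (hH : ContainsElementary L H) {k : Fin g} (a c : Fin g → R) {d b : Fin g → R}
    (hd : ∀ i ≤ k, d i = 0) (hb : ∀ i ≤ k, b i = 0) (t : R) :
    ∃ h ∈ H, FixesBelow k.1 h ∧ ∃ a' c' x, h.1 *ᵥ Sum.elim a c = Sum.elim a' c' ∧ a' k = a k ∧
      c' k = c k + t * (L * (d ⬝ᵥ a - b ⬝ᵥ c)) + a k * x := by
  have hy : ((L * t) • b) k = 0 := by simp [hb k le_rfl]
  have hdL : ∀ (v : Fin g → R) (i : Fin g), L ∣ ((L * t) • v) i := fun v i =>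
    Dvd.intro (t * v i) (by simp [mul_assoc])
  have h1 := hH.low_mem _ (isSymm_cross k ((L * t) • d) 0) (dvd_cross k (hdL d) (dvd_zero _))
  have h2 := hH.levi_mem k _ hy (hdL b)
  refine ⟨_, mul_mem h2 h1, (fixesBelow_levi_colUnit k hy).mul (fixesBelow_low _ fun i hi =>
    cross_mulVec_single hi (by simp [hd i (le_of_lt hi)])), ?_⟩
  -- The cross term of the two matrices; as a multiple of `a k` it does not affect coprimality with
  -- `a k`.
  refine ⟨_, _, -((L * t) ^ 2 * (b ⬝ᵥ d)), by
    rw [Submonoid.coe_mul, ← mulVec_mulVec, low_mulVec, levi_colUnit_mulVec], ?_, ?_⟩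
  · simp [hb k le_rfl]
  · rw [cross_mulVec]
    simp [hb k le_rfl, hd k le_rfl, dotProduct_add, smul_dotProduct]
    ring

/-- The coordinates of `X e_k` from the `k`-th hyperbolic plane on form a unimodular row. -/
theorem FixesBelow.exists_unimodular {k : Fin g} {X : Sp g R} (hX : FixesBelow k.1 X)
    {a c : Fin g → R} (hac : X.1 *ᵥ basisE R k = Sum.elim a c) :
    ∃ (d b : Fin g → R) (α β : R), (∀ i ≤ k, d i = 0) ∧ (∀ i ≤ k, b i = 0) ∧
      a k * α - c k * β + (d ⬝ᵥ a - b ⬝ᵥ c) = 1 := by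
  obtain ⟨b, d, hbd⟩ : ∃ b d, X.1 *ᵥ basisF R k = Sum.elim b d :=
    ⟨_, _, (Sum.elim_comp_inl_inr _).symm⟩
  have hc0 : ∀ i : Fin g, i < k → c i = 0 := fun i hi => by
    have := hX.eq_zero (v := basisE R k) hi (by simp [basisE])
    simpa [hac] using this
  have hd0 : ∀ i : Fin g, i < k → d i = 0 := fun i hi => by
    have := hX.eq_zero (v := basisF R k) hi (by simp [basisF, hi.ne])
    simpa [hbd] using this
  -- The pairing of `X e_k` with `X f_k` is `-1`. Their `f` coordinates below `k` vanish, so only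
  -- plane `k` and the later ones contribute.
  have hform := form_mulVec X (basisE R k) (basisF R k)
  rw [hac, hbd, basisE, basisF, form_elim, form_elim] at hform
  simp only [zero_dotProduct, single_one_dotProduct, Pi.single_eq_same, zero_sub] at hform
  let T : (Fin g → R) → Fin g → R := fun v i => if k < i then v i else 0
  have hT : ∀ v i, i ≤ k → T v i = 0 := fun v i hi => by simp [T, hi.not_gt]
  have hsplit : ∀ v : Fin g → R, (∀ i < k, v i = 0) → v = Pi.single k (v k) + T v := by
    intro v hv
    ext i
    rcases lt_trichotomy i k with h | h | h
    · simp [hv i h, h.ne, hT v i h.le]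
    · subst h; simp [hT v i le_rfl]
    · simp [T, h, h.ne']
  have hswap : T c ⬝ᵥ b = T b ⬝ᵥ c := by
    refine Finset.sum_congr rfl fun i _ => ?_
    simp only [T]
    split_ifs <;> ring
  refine ⟨T d, T b, d k, b k, hT d, hT b, ?_⟩
  have e1 : a ⬝ᵥ d = a k * d k + T d ⬝ᵥ a := by
    conv_lhs => rw [hsplit d hd0]
    rw [dotProduct_add, dotProduct_single, dotProduct_comm (T d)]
  have e2 : c ⬝ᵥ b = c k * b k + T b ⬝ᵥ c := by
    conv_lhs => rw [hsplit c hc0]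
    rw [add_dotProduct, single_dotProduct, hswap]
  rw [e1, e2] at hform
  linear_combination -hform

/-- Take `t` to be the product of the primes dividing `a` but not `c`. A prime of `a` then divides
exactly one of `c` and `t * r`, since one dividing both `a` and `c` cannot divide `r`. -/
theorem exists_isCoprime_add_mul {a c r : ℤ} (ha : a ≠ 0) (h : ∃ u v w, a * u + c * v + r * w = 1) :
    ∃ t, IsCoprime a (c + t * r) := by
  classical
  obtain ⟨u, v, w, h⟩ := h
  let s : Finset ℕ := a.natAbs.primeFactors.filter fun p => ¬ (p : ℤ) ∣ c
  refine ⟨∏ p ∈ s, (p : ℤ), ?_⟩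
  rw [Int.isCoprime_iff_gcd_eq_one]
  refine Nat.coprime_of_dvd fun p hp h1 h2 => ?_
  rw [← Int.natCast_dvd] at h1 h2
  have hpp : Prime (p : ℤ) := Nat.prime_iff_prime_int.1 hp
  by_cases hc : (p : ℤ) ∣ c
  · rcases hpp.dvd_or_dvd ((dvd_add_right hc).1 h2) with h3 | h3
    · obtain ⟨q, hq, hpq⟩ := (hpp.dvd_finsetProd_iff _).1 h3
      obtain ⟨hq1, hq2⟩ := Finset.mem_filter.1 hq
      rw [Int.natCast_dvd_natCast,
        Nat.prime_dvd_prime_iff_eq hp (Nat.prime_of_mem_primeFactors hq1)] at hpq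
      exact hq2 (hpq ▸ hc)
    · exact hpp.not_dvd_one (h ▸ dvd_add (dvd_add (h1.mul_right _) (hc.mul_right _))
        (h3.mul_right _))
  · refine hc ((dvd_add_left (Dvd.dvd.mul_right (Finset.dvd_prod_of_mem _ ?_) _)).1 h2)
    refine Finset.mem_filter.2 ⟨Nat.mem_primeFactors.2 ⟨hp, Int.natCast_dvd.1 h1, ?_⟩, hc⟩
    simpa using ha

theorem long_mulVec (k : Fin g) (M : SL(2, ℤ)) (a c : Fin g → ℤ) :
    (long k M).1 *ᵥ Sum.elim a c =
      Sum.elim (a + ((M 0 0 - 1) * a k + M 0 1 * c k) • Pi.single k 1)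
        (c + (M 1 0 * a k + (M 1 1 - 1) * c k) • Pi.single k 1) := by
  rw [coe_long, fromBlocks_mulVec]
  simp only [Sum.elim_comp_inl, Sum.elim_comp_inr, add_mulVec, one_mulVec, single_mulVec]
  congr 1 <;>
  · ext i
    by_cases h : i = k
    · subst h; simp; try ring
    · simp [h]

theorem fixesBelow_long (k : Fin g) (M : SL(2, ℤ)) : FixesBelow k.1 (long k M) := fun i hi => by
  have : k ≠ i := by rintro rfl; exact lt_irrefl _ hi
  rw [basisE, long_mulVec]
  simp [this]

/-- Congruence matrices are products of elementary matrices and matrices in the subgroups `SL₂`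
of the hyperbolic planes. -/
theorem cong_le {n : ℕ} (hn : 1 ≤ n) {H : Subgroup (Sp g ℤ)} (hHc : H ≤ cong g (2 ^ n))
    (hH : ContainsElementary ((2 ^ n : ℕ) : ℤ) H)
    (hlong : ∀ k, ∀ M ∈ CongruenceSubgroup.Gamma (2 ^ n), long k M ∈ H) : cong g (2 ^ n) ≤ H := by
  refine le_of_normalizes hHc (fun X hX => mem_cong_iff.1 hX) hH fun k X hX hfix => ?_
  obtain ⟨a, c, hac⟩ : ∃ a c, X.1 *ᵥ basisE ℤ k = Sum.elim a c :=
    ⟨_, _, (Sum.elim_comp_inl_inr _).symm⟩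
  obtain ⟨d, b, α, β, hd, hb, huni⟩ := hfix.exists_unimodular hac
  have hak : ((2 ^ n : ℕ) : ℤ) ∣ a k - 1 := by
    have := mem_cong_iff.1 hX (Sum.inl k) (Sum.inl k)
    rw [← mulVec_basisE X.1, hac] at this
    simpa using this
  have ha0 : a k ≠ 0 := by
    intro h0
    rw [h0, zero_sub, dvd_neg] at hak
    have h2 : (2 : ℤ) ∣ ((2 ^ n : ℕ) : ℤ) := by
      exact_mod_cast dvd_pow_self 2 (Nat.one_le_iff_ne_zero.1 hn)
    have : (2 : ℤ) ∣ 1 := h2.trans hak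
    exact absurd this (by decide)
  -- As `a k ≡ 1` modulo `2 ^ n`, the row stays unimodular after its last entry is multiplied by `2
  -- ^ n`.
  obtain ⟨t, ht⟩ : ∃ t, IsCoprime (a k) (c k + t * (((2 ^ n : ℕ) : ℤ) * (d ⬝ᵥ a - b ⬝ᵥ c))) := by
    refine exists_isCoprime_add_mul ha0 ?_
    obtain ⟨m, hm⟩ := hak
    exact ⟨α + (d ⬝ᵥ a - b ⬝ᵥ c), -β, -m, by linear_combination huni + (d ⬝ᵥ a - b ⬝ᵥ c) * hm⟩
  obtain ⟨h, hh, hhfix, a', c', x, hv, ha', hc'⟩ := hH.exists_shift a c hd hb t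
  have hY : h * X ∈ cong g (2 ^ n) := mul_mem (hHc hh) hX
  have hYv : (h * X).1 *ᵥ basisE ℤ k = Sum.elim a' c' := by
    rw [Submonoid.coe_mul, ← mulVec_mulVec, hac, hv]
  have hck : ((2 ^ n : ℕ) : ℤ) ∣ c' k := by
    have := mem_cong_iff.1 hY (Sum.inr k) (Sum.inl k)
    rw [← mulVec_basisE (h * X).1, hYv] at this
    simpa using this
  have hcop : IsCoprime (a k) (c' k) := by
    rw [hc']
    exact ht.add_mul_left_right x
  obtain ⟨p, q, hpq, hM, hp, hq⟩ := SymbolSL2.exists_mk_mem_Gamma hak hck hcop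
  -- The first row `(q, -p)` sends the pair `(a k, c' k)` to `1`.
  have hdet : q * a k - -p * -c' k = 1 := by linear_combination hpq
  have hN : SymbolSL2.mk q (-p) (-c' k) (a k) hdet ∈ CongruenceSubgroup.Gamma (2 ^ n) :=
    SymbolSL2.mk_mem_Gamma_iff.2 ⟨hq, hp.neg_right, hck.neg_right, hak⟩
  refine ⟨_, mul_mem (hlong k _ hN) hh, (fixesBelow_long k _).mul hhfix, ?_⟩
  rw [mul_assoc, Submonoid.coe_mul, ← mulVec_mulVec, hYv, long_mulVec]
  simp [ha']
  linear_combination hpq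

/-- A congruence subgroup of level `2 ^ n` lies in its commutator with the symplectic group. -/
theorem cong_le_commutator (hg : 3 ≤ g) {n : ℕ} (hn : 1 ≤ n) :
    cong g (2 ^ n) ≤ ⁅cong g (2 ^ n), (⊤ : Subgroup (Sp g ℤ))⁆ := by
  -- In this quotient the congruence subgroup becomes central, so all the vanishing results apply to
  -- `φ`.
  let φ := QuotientGroup.mk' ⁅cong g (2 ^ n), (⊤ : Subgroup (Sp g ℤ))⁆
  have hφ : CentralOn φ (cong g (2 ^ n)) := by
    intro γ hγ x
    rw [← mul_inv_eq_one, ← map_inv, ← map_mul, ← MonoidHom.mem_ker, QuotientGroup.ker_mk',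
      Subgroup.commutator_comm]
    exact Subgroup.commutator_mem_commutator (Subgroup.mem_top x) hγ
  have key : cong g (2 ^ n) ≤ φ.ker ⊓ cong g (2 ^ n) := by
    refine cong_le hn inf_le_right ⟨?_, ?_, ?_⟩ ?_
    · exact fun B h hB => ⟨map_up_eq_one hg hφ h hB, up_mem_cong h hB⟩
    · exact fun B h hB => ⟨map_low_eq_one hg hφ h hB, low_mem_cong h hB⟩
    · exact fun k y hy hN => ⟨map_levi_colUnit_eq_one hg hφ k hy hN, levi_colUnit_mem_cong k hy hN⟩
    · exact fun k M hM => ⟨map_long_eq_one hg hn hφ k hM, long_mem_cong k hM⟩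
  exact (key.trans inf_le_left).trans (QuotientGroup.ker_mk' _).le

/-! ### Generation over local rings and surjectivity of reduction. -/

/-- Over a local ring, elementary matrices generate the symplectic group. -/
theorem eq_top_of_containsElementary [IsLocalRing R] {H : Subgroup (Sp g R)}
    (hH : ContainsElementary 1 H) : H = ⊤ := by
  refine top_le_iff.1 (le_of_normalizes le_top (fun X _ p q => one_dvd _) hH fun k X _ hfix => ?_)
  obtain ⟨a, c, hac⟩ : ∃ a c, X.1 *ᵥ basisE R k = Sum.elim a c :=
    ⟨_, _, (Sum.elim_comp_inl_inr _).symm⟩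
  obtain ⟨d, b, α, β, hd, hb, huni⟩ := hfix.exists_unimodular hac
  -- The coordinate `c k` is first made a unit: either it is one, or `a k` is and can be used to
  -- correct it, or locality makes the remaining term of the unimodular row a unit. An upper
  -- unipotent then normalises `a k`.
  obtain ⟨h, hh, hhfix, a', c', hv, hc'⟩ : ∃ h ∈ H, FixesBelow k.1 h ∧ ∃ a' c',
      h.1 *ᵥ Sum.elim a c = Sum.elim a' c' ∧ IsUnit (c' k) := by
    by_cases hc : IsUnit (c k)
    · exact ⟨1, one_mem _, fun i _ => by simp, a, c, by simp, hc⟩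
    by_cases ha : IsUnit (a k)
    · obtain ⟨u, hu⟩ := ha.exists_right_inv
      refine ⟨low _ (isSymm_cross k 0 (u * (1 - c k))), hH.low_mem _ _ fun _ _ => one_dvd _,
        fixesBelow_low _ fun i hi => cross_mulVec_single hi rfl, _, _, low_mulVec _ _ _, ?_⟩
      rw [cross_mulVec]
      have : u * (1 - c k) * a k + c k = 1 := by linear_combination (1 - c k) * hu
      simp [this]
    · have hr : IsUnit (d ⬝ᵥ a - b ⬝ᵥ c) := by
        refine (IsLocalRing.isUnit_or_isUnit_of_add_one huni).resolve_left fun h => ?_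
        rw [sub_eq_add_neg, ← mul_neg] at h
        rcases IsLocalRing.isUnit_or_isUnit_of_isUnit_add h with h | h
        · exact ha (isUnit_of_mul_isUnit_left h)
        · exact hc (isUnit_of_mul_isUnit_left h)
      obtain ⟨t, ht⟩ := hr.exists_right_inv
      obtain ⟨h, hh, hhfix, a', c', x, hv, ha', hc'⟩ := hH.exists_shift a c hd hb t
      refine ⟨h, hh, hhfix, a', c', hv, ?_⟩
      have e : c' k + -(c k + a k * x) = 1 := by rw [hc']; linear_combination ht
      refine (IsLocalRing.isUnit_or_isUnit_of_add_one e).resolve_right fun h => ?_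
      rcases IsLocalRing.isUnit_or_isUnit_of_isUnit_add ((IsUnit.neg_iff _).1 h) with h | h
      · exact hc h
      · exact ha (isUnit_of_mul_isUnit_left h)
  obtain ⟨u, hu⟩ := hc'.exists_right_inv
  refine ⟨_, mul_mem (hH.up_mem (single k k (u * (1 - a' k))) (by simp) fun _ _ => one_dvd _) hh,
    (fixesBelow_up _ _).mul hhfix, ?_⟩
  rw [mul_assoc, Submonoid.coe_mul, Submonoid.coe_mul, ← mulVec_mulVec, ← mulVec_mulVec, hac, hv,
    up_mulVec]
  simp [single_mulVec]
  linear_combination (1 - a' k) * hu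

theorem coe_reduction (N : ℕ) (X : Sp g ℤ) :
    (reduction g N X).1 = X.1.map (Int.castRingHom (ZMod N)) := rfl

/-- Elementary matrices lift entry by entry to `ℤ`, and over a local ring they generate. -/
theorem reduction_surjective {N : ℕ} [IsLocalRing (ZMod N)] : Function.Surjective (reduction g N) := by
  rw [← MonoidHom.range_eq_top]
  refine eq_top_of_containsElementary ⟨fun B h _ => ?_, fun B h _ => ?_, fun k y hy _ => ?_⟩
  · refine ⟨up (B.map ZMod.cast) (by rw [← transpose_map, h]), Subtype.ext ?_⟩
    rw [coe_reduction, coe_up, coe_up, fromBlocks_map]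
    simp [Function.comp_def]
  · refine ⟨low (B.map ZMod.cast) (by rw [← transpose_map, h]), Subtype.ext ?_⟩
    rw [coe_reduction, coe_low, coe_low, fromBlocks_map]
    simp [Function.comp_def]
  · refine ⟨levi (colUnit k (fun i => (y i).cast) (by simp [hy])), Subtype.ext ?_⟩
    rw [coe_reduction, coe_levi, coe_levi, fromBlocks_map, coe_inv_colUnit, coe_colUnit,
      coe_inv_colUnit, coe_colUnit]
    congr 1 <;>
    · ext i j
      by_cases hj : j = k <;> by_cases hi : i = k <;>
        simp [vecMulVec_apply, Matrix.one_apply, hi, hj, apply_ite] <;> grind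

instance (n : ℕ) [NeZero n] : IsLocalRing (ZMod (2 ^ n)) :=
  have : Fact (1 < 2 ^ n) := ⟨Nat.one_lt_two_pow (NeZero.ne n)⟩
  IsLocalRing.of_surjective' (PadicInt.toZModPow (p := 2) n) (ZMod.ringHom_surjective _)

end Sp

/-! ### The kernel of `Sp(2g, ℤ/4) → 𝔥`. -/

namespace Sp

variable {g : ℕ}

theorem two_smul_mul_two_smul (X Y : Matrix (Fin g ⊕ Fin g) (Fin g ⊕ Fin g) (ZMod 4)) :
    (1 + (2 : ZMod 4) • X) * (1 + (2 : ZMod 4) • Y) = 1 + (2 : ZMod 4) • (X + Y) := by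
  have : (2 : ZMod 4) * 2 = 0 := rfl
  rw [mul_add, add_mul, add_mul, smul_mul_smul_comm, this]
  simp [smul_add, add_assoc]

/-- The element `1 + 2 J (L + Lᵀ)` of the symplectic group over `ℤ/4`. -/
def symElem (L : Matrix (Fin g ⊕ Fin g) (Fin g ⊕ Fin g) (ZMod 4)) : Sp g (ZMod 4) :=
  ⟨1 + (2 : ZMod 4) • (J (Fin g) (ZMod 4) * (L + Lᵀ)), by
    have hS : (L + Lᵀ)ᵀ = L + Lᵀ := by simp [add_comm]
    generalize L + Lᵀ = S at hS
    have hJ := J_squared (Fin g) (ZMod 4)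
    rw [SymplecticGroup.mem_iff]
    have e : J (Fin g) (ZMod 4) * (1 + (2 : ZMod 4) • (J (Fin g) (ZMod 4) * S))ᵀ =
        (1 + (2 : ZMod 4) • -(J (Fin g) (ZMod 4) * S)) * J (Fin g) (ZMod 4) := by
      simp [transpose_mul, hS, mul_add, add_mul, mul_assoc]
    rw [mul_assoc, e, ← mul_assoc, two_smul_mul_two_smul]
    simp⟩

theorem coe_symElem (L : Matrix (Fin g ⊕ Fin g) (Fin g ⊕ Fin g) (ZMod 4)) :
    (symElem L).1 = 1 + (2 : ZMod 4) • (J (Fin g) (ZMod 4) * (L + Lᵀ)) := rfl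

theorem symElem_add (L M : Matrix (Fin g ⊕ Fin g) (Fin g ⊕ Fin g) (ZMod 4)) :
    symElem (L + M) = symElem L * symElem M := by
  refine Subtype.ext ?_
  rw [Submonoid.coe_mul, coe_symElem, coe_symElem, coe_symElem, two_smul_mul_two_smul, ← mul_add,
    transpose_add]
  congr 3
  abel

theorem symElem_transpose (L : Matrix (Fin g ⊕ Fin g) (Fin g ⊕ Fin g) (ZMod 4)) :
    symElem Lᵀ = symElem L :=
  Subtype.ext (by rw [coe_symElem, coe_symElem, transpose_transpose, add_comm L])

theorem symElem_eq_one {L : Matrix (Fin g ⊕ Fin g) (Fin g ⊕ Fin g) (ZMod 4)}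
    (h : (2 : ZMod 4) • (L + Lᵀ) = 0) : symElem L = 1 :=
  Subtype.ext (by rw [coe_symElem, ← mul_smul_comm, h]; simp)

/-- From `X J Xᵀ = J`: conjugation acts on `L` as a change of basis of a bilinear form. -/
theorem symElem_conj (X : Sp g (ZMod 4)) (L : Matrix (Fin g ⊕ Fin g) (Fin g ⊕ Fin g) (ZMod 4)) :
    X⁻¹ * symElem L * X = symElem (X.1ᵀ * L * X.1) := by
  rw [mul_assoc, inv_mul_eq_iff_eq_mul]
  refine Subtype.ext ?_
  have hX := SymplecticGroup.mem_iff.1 X.2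
  have e : X.1 * (J (Fin g) (ZMod 4) * (X.1ᵀ * L * X.1 + (X.1ᵀ * L * X.1)ᵀ)) =
      X.1 * J (Fin g) (ZMod 4) * X.1ᵀ * (L + Lᵀ) * X.1 := by
    simp only [transpose_mul, transpose_transpose]
    noncomm_ring
  rw [Submonoid.coe_mul, Submonoid.coe_mul, coe_symElem, coe_symElem, mul_add X.1, mul_smul_comm, e, hX]
  simp [add_mul]

/-- The matrices whose associated symplectic element lies in a given subgroup. -/
def symSubmodule (C : Subgroup (Sp g (ZMod 4))) :
    Submodule (ZMod 4) (Matrix (Fin g ⊕ Fin g) (Fin g ⊕ Fin g) (ZMod 4)) :=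
  AddSubgroup.toZModSubmodule 4
    { carrier := {L | symElem L ∈ C}
      zero_mem' := by
        have : symElem (0 : Matrix (Fin g ⊕ Fin g) (Fin g ⊕ Fin g) (ZMod 4)) = 1 :=
          symElem_eq_one (by simp)
        simp [this]
      add_mem' := fun {L M} hL hM => by
        rw [Set.mem_ofPred_eq, symElem_add]
        exact mul_mem hL hM
      neg_mem' := fun {L} hL => by
        have : symElem (-L) = (symElem L)⁻¹ := by
          rw [eq_inv_iff_mul_eq_one, ← symElem_add]
          exact symElem_eq_one (by simp)
        rw [Set.mem_ofPred_eq, this]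
        exact inv_mem hL }

theorem mem_symSubmodule {C : Subgroup (Sp g (ZMod 4))}
    {L : Matrix (Fin g ⊕ Fin g) (Fin g ⊕ Fin g) (ZMod 4)} :
    L ∈ symSubmodule C ↔ symElem L ∈ C := Iff.rfl

/-- The parity condition for matrices of the form `1 + 2 J (L + Lᵀ)`. -/
def EvenTrace (L : Matrix (Fin g ⊕ Fin g) (Fin g ⊕ Fin g) (ZMod 4)) : Prop :=
  2 * (J (Fin g) (ZMod 4) * L).trace = 0

theorem evenTrace_fromBlocks {A B C D : Matrix (Fin g) (Fin g) (ZMod 4)} :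
    EvenTrace (fromBlocks A B C D) ↔ 2 * (B.trace + C.trace) = 0 := by
  have h4 : (4 : ZMod 4) = 0 := rfl
  rw [EvenTrace, J, fromBlocks_multiply]
  simp only [Matrix.trace, Fintype.sum_sum_type, Matrix.diag_apply, fromBlocks_apply₁₁, fromBlocks_apply₂₂, Matrix.neg_apply, Finset.sum_neg_distrib, zero_mul, one_mul, zero_add, neg_mul, add_zero]
  refine Eq.congr_left ?_
  linear_combination (-∑ x, C x x) * h4

section perfect

variable {K : Subgroup (Sp g (ZMod 4))}

/-- The commutator of `X⁻¹` with `symElem L` is `symElem (Xᵀ L X - L)`, so the problem becomes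
linear in `L`. -/
theorem conj_sub_mem (hK : ∀ L, EvenTrace L → symElem L ∈ K)
    {L : Matrix (Fin g ⊕ Fin g) (Fin g ⊕ Fin g) (ZMod 4)} (hL : EvenTrace L) (X : Sp g (ZMod 4)) :
    X.1ᵀ * L * X.1 - L ∈ symSubmodule ⁅K, (⊤ : Subgroup (Sp g (ZMod 4)))⁆ := by
  have h : symElem (X.1ᵀ * L * X.1 - L) = ⁅X⁻¹, symElem L⁆ := by
    rw [commutatorElement_def, inv_inv, symElem_conj, eq_mul_inv_iff_mul_eq, ← symElem_add,
      sub_add_cancel]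
  rw [mem_symSubmodule, h, Subgroup.commutator_comm]
  exact Subgroup.commutator_mem_commutator (Subgroup.mem_top _) (hK L hL)

theorem conj_sub_mem_fromBlocks (hK : ∀ L, EvenTrace L → symElem L ∈ K) {j l : Fin g} (hjl : j ≠ l)
    {A B D : Matrix (Fin g) (Fin g) (ZMod 4)} (hB : B.trace = 0) :
    fromBlocks ((1 + single l j 1) * A * (1 + single j l 1) - A)
      ((1 + single l j 1) * B * (1 - single l j 1) - B) 0
      ((1 - single j l 1) * D * (1 - single l j 1) - D) ∈
      symSubmodule ⁅K, (⊤ : Subgroup (Sp g (ZMod 4)))⁆ := by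
  have hy : (Pi.single j 1 : Fin g → ZMod 4) l = 0 := by simp [hjl]
  have h := conj_sub_mem hK (L := fromBlocks A B 0 D) (evenTrace_fromBlocks.2 (by simp [hB]))
    (levi (colUnit l (Pi.single j 1) hy))
  rw [coe_levi, coe_colUnit, coe_inv_colUnit, ← single_eq_single_vecMulVec_single,
    fromBlocks_transpose, fromBlocks_multiply, fromBlocks_multiply, sub_eq_add_neg, fromBlocks_neg,
    fromBlocks_add] at h
  simpa [sub_eq_add_neg] using h

theorem single_eq_smul_one (i j : Fin g) (t : ZMod 4) :
    single i j t = t • single i j (1 : ZMod 4) := by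
  rw [smul_single, smul_eq_mul, mul_one]

/-- `E_ij` with `i ≠ j` arises from `E_im` for a third index `m`. For `i = j` the associated element
is trivial, because `2 * (1 + 1) = 0`. -/
theorem fromBlocks_inl_mem (hg : 3 ≤ g) (hK : ∀ L, EvenTrace L → symElem L ∈ K)
    (A : Matrix (Fin g) (Fin g) (ZMod 4)) :
    fromBlocks A 0 0 0 ∈ symSubmodule ⁅K, (⊤ : Subgroup (Sp g (ZMod 4)))⁆ := by
  induction A using Matrix.induction_on' with
  | h_zero => simp
  | h_add p q hp hq => simpa [fromBlocks_add] using add_mem hp hq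
  | h_std_basis i j t =>
    have e : fromBlocks (single i j t) 0 0 (0 : Matrix (Fin g) (Fin g) (ZMod 4)) =
        t • fromBlocks (single i j 1) 0 0 0 := by
      rw [single_eq_smul_one, fromBlocks_smul]; simp
    rw [e]
    refine Submodule.smul_mem _ _ ?_
    by_cases hij : i = j
    · subst hij
      rw [mem_symSubmodule, symElem_eq_one]
      · exact one_mem _
      · have h4 : (2 : ZMod 4) * (1 + 1) = 0 := rfl
        simp [fromBlocks_transpose, fromBlocks_add, fromBlocks_smul, ← single_add, h4]
    · obtain ⟨m, hmi, hmj⟩ := exists_ne_ne hg i j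
      have := conj_sub_mem_fromBlocks hK hmj (A := single i m 1) (B := 0) (D := 0) (by simp)
      simpa [add_mul, mul_add, hmi, hmi.symm, hij, Ne.symm hij] using this

theorem fromBlocks_inr_mem (hg : 3 ≤ g) (hK : ∀ L, EvenTrace L → symElem L ∈ K)
    (A : Matrix (Fin g) (Fin g) (ZMod 4)) :
    fromBlocks 0 0 0 A ∈ symSubmodule ⁅K, (⊤ : Subgroup (Sp g (ZMod 4)))⁆ := by
  induction A using Matrix.induction_on' with
  | h_zero => simp
  | h_add p q hp hq => simpa [fromBlocks_add] using add_mem hp hq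
  | h_std_basis i j t =>
    have e : fromBlocks (0 : Matrix (Fin g) (Fin g) (ZMod 4)) 0 0 (single i j t) =
        t • fromBlocks 0 0 0 (single i j 1) := by
      rw [single_eq_smul_one, fromBlocks_smul]; simp
    rw [e]
    refine Submodule.smul_mem _ _ ?_
    by_cases hij : i = j
    · subst hij
      rw [mem_symSubmodule, symElem_eq_one]
      · exact one_mem _
      · have h4 : (2 : ZMod 4) * (1 + 1) = 0 := rfl
        simp [fromBlocks_transpose, fromBlocks_add, fromBlocks_smul, ← single_add, h4]
    · obtain ⟨m, hmi, hmj⟩ := exists_ne_ne hg i j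
      have := conj_sub_mem_fromBlocks hK hmj.symm (A := 0) (B := 0) (D := single i m 1) (by simp)
      rw [← neg_mem_iff]
      simpa [sub_mul, mul_sub, hmi, hmi.symm, hij, Ne.symm hij, fromBlocks_neg] using this

theorem fromBlocks_cross_single_mem (hg : 3 ≤ g) (hK : ∀ L, EvenTrace L → symElem L ∈ K)
    {i j : Fin g} (hij : i ≠ j) : fromBlocks 0 (single i j 1) 0 0 ∈
      symSubmodule ⁅K, (⊤ : Subgroup (Sp g (ZMod 4)))⁆ := by
  obtain ⟨m, hmi, hmj⟩ := exists_ne_ne hg i j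
  have := conj_sub_mem_fromBlocks hK hmj.symm (A := 0) (B := single i m 1) (D := 0)
    (by simp [hmi.symm])
  rw [← neg_mem_iff]
  simpa [add_mul, mul_sub, hmi, hmi.symm, hij, Ne.symm hij, fromBlocks_neg] using this

/-- Starting from `E_ji`, conjugation produces `E_ii - E_jj - E_ij`, and the last term is already
known. -/
theorem fromBlocks_cross_diag_mem (hg : 3 ≤ g) (hK : ∀ L, EvenTrace L → symElem L ∈ K)
    (i j : Fin g) : fromBlocks 0 (single i i 1 - single j j 1) 0 0 ∈
      symSubmodule ⁅K, (⊤ : Subgroup (Sp g (ZMod 4)))⁆ := by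
  by_cases hij : i = j
  · simp [hij]
  have := add_mem (conj_sub_mem_fromBlocks hK (Ne.symm hij) (A := 0) (B := single j i 1) (D := 0)
    (by simp [Ne.symm hij])) (fromBlocks_cross_single_mem hg hK hij)
  rw [fromBlocks_add] at this
  convert this using 2 <;> simp [add_mul, mul_sub]
  abel

theorem fromBlocks_cross_mem (hg : 3 ≤ g) (hK : ∀ L, EvenTrace L → symElem L ∈ K)
    {B : Matrix (Fin g) (Fin g) (ZMod 4)} (hB : 2 * B.trace = 0) : fromBlocks 0 B 0 0 ∈
      symSubmodule ⁅K, (⊤ : Subgroup (Sp g (ZMod 4)))⁆ := by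
  let o : Fin g := ⟨0, by omega⟩
  -- Modulo commutators `B` reduces to its trace in a single diagonal place; evenness of the trace
  -- makes that remainder trivial.
  have key : fromBlocks 0 (B - single o o B.trace) 0 0 ∈
      symSubmodule ⁅K, (⊤ : Subgroup (Sp g (ZMod 4)))⁆ := by
    clear hB
    induction B using Matrix.induction_on' with
    | h_zero => simp
    | h_add p q hp hq =>
      convert add_mem hp hq using 1
      simp [fromBlocks_add, single_add]
      abel
    | h_std_basis i j t =>
      by_cases hij : i = j
      · subst hij
        convert Submodule.smul_mem _ t (fromBlocks_cross_diag_mem hg hK i o) using 1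
        simp [fromBlocks_smul, smul_sub]
      · convert Submodule.smul_mem _ t (fromBlocks_cross_single_mem hg hK hij) using 1
        simp [fromBlocks_smul, trace_single_eq_of_ne _ _ _ hij]
  have h2 : fromBlocks (0 : Matrix (Fin g) (Fin g) (ZMod 4)) (single o o B.trace) 0 0 ∈
      symSubmodule ⁅K, (⊤ : Subgroup (Sp g (ZMod 4)))⁆ := by
    rw [mem_symSubmodule, symElem_eq_one]
    · exact one_mem _
    · simp [fromBlocks_transpose, fromBlocks_add, fromBlocks_smul, hB]
  simpa [fromBlocks_add] using add_mem key h2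

/-- The elements `1 + 2 J (L + Lᵀ)` satisfying the parity condition are products of commutators. -/
theorem symElem_mem_commutator (hg : 3 ≤ g) (hK : ∀ L, EvenTrace L → symElem L ∈ K)
    {L : Matrix (Fin g ⊕ Fin g) (Fin g ⊕ Fin g) (ZMod 4)} (hL : EvenTrace L) :
    symElem L ∈ ⁅K, (⊤ : Subgroup (Sp g (ZMod 4)))⁆ := by
  obtain ⟨A, B, C, D, rfl⟩ : ∃ A B C D, L = fromBlocks A B C D :=
    ⟨_, _, _, _, (fromBlocks_toBlocks L).symm⟩
  rw [evenTrace_fromBlocks] at hL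
  rw [← mem_symSubmodule]
  have h1 := fromBlocks_inl_mem hg hK A
  have h2 := fromBlocks_inr_mem hg hK D
  have h3 := fromBlocks_cross_mem hg hK (B := B + Cᵀ) (by rw [trace_add, trace_transpose, hL])
  -- An antisymmetric matrix has trivial associated element; subtracting this one moves `C` into the
  -- upper right block.
  have h4 : fromBlocks 0 Cᵀ (-C) 0 ∈ symSubmodule ⁅K, (⊤ : Subgroup (Sp g (ZMod 4)))⁆ := by
    rw [mem_symSubmodule, symElem_eq_one]
    · exact one_mem _
    · simp [fromBlocks_transpose, fromBlocks_add]
  convert sub_mem (add_mem (add_mem h1 h2) h3) h4 using 1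
  simp [fromBlocks_add, sub_eq_add_neg, fromBlocks_neg]

end perfect

theorem map_J_mul (N : ℕ) (L : Matrix (Fin g ⊕ Fin g) (Fin g ⊕ Fin g) ℤ) :
    (J (Fin g) ℤ * L).map (Int.castRingHom (ZMod N)) =
      J (Fin g) (ZMod N) * L.map (Int.castRingHom (ZMod N)) := by
  rw [Matrix.map_mul, map_J]

theorem two_mul_trace_map (L : Matrix (Fin g ⊕ Fin g) (Fin g ⊕ Fin g) ℤ) :
    2 * (J (Fin g) (ZMod 4) * L.map (Int.castRingHom (ZMod 4))).trace =
      ((2 * (J (Fin g) ℤ * L).trace : ℤ) : ZMod 4) := by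
  rw [← map_J_mul]
  simp [Matrix.trace]

theorem coe_symElem_map (L : Matrix (Fin g ⊕ Fin g) (Fin g ⊕ Fin g) ℤ) (p q : Fin g ⊕ Fin g) :
    (symElem (L.map (Int.castRingHom (ZMod 4)))).1 p q =
      (((1 : Matrix (Fin g ⊕ Fin g) (Fin g ⊕ Fin g) ℤ) p q +
        2 * (J (Fin g) ℤ * (L + Lᵀ)) p q : ℤ) : ZMod 4) := by
  have : L.map (Int.castRingHom (ZMod 4)) + (L.map (Int.castRingHom (ZMod 4)))ᵀ =
      (L + Lᵀ).map (Int.castRingHom (ZMod 4)) := by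
    rw [Matrix.map_add _ (map_add _), transpose_map]
  rw [coe_symElem, this, ← map_J_mul]
  simp [Matrix.one_apply]

/-- By `inK_iff`, membership in `𝔎` depends only on the matrix modulo `4`, so any preimage under
reduction works. -/
theorem exists_mem_frakK_reduction_eq {L : Matrix (Fin g ⊕ Fin g) (Fin g ⊕ Fin g) (ZMod 4)}
    (hL : EvenTrace L) : ∃ X ∈ frakK g, reduction g 4 X = symElem L := by
  obtain ⟨L, rfl⟩ : ∃ L' : Matrix _ _ ℤ, L'.map (Int.castRingHom (ZMod 4)) = L :=
    ⟨L.map ZMod.cast, by ext; simp⟩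
  obtain ⟨X, hX⟩ := reduction_surjective (g := g) (N := 2 ^ 2)
    (symElem (L.map (Int.castRingHom (ZMod 4))))
  have h : ∀ p q, ∃ e : ℤ, X.1 p q = (1 : Matrix (Fin g ⊕ Fin g) (Fin g ⊕ Fin g) ℤ) p q +
      2 * (J (Fin g) ℤ * (L + Lᵀ)) p q + 4 * e := by
    intro p q
    have h1 : ((X.1 p q : ℤ) : ZMod 4) = _ :=
      (congrFun (congrFun (congrArg Subtype.val hX) p) q).trans (coe_symElem_map L p q)
    obtain ⟨e, he⟩ := (ZMod.intCast_eq_intCast_iff_dvd_sub _ _ _).1 h1.symm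
    exact ⟨e, by push_cast at he; linarith⟩
  choose E hE using h
  refine ⟨X, (inK_iff X).2 ⟨L, of E, ?_, ?_⟩, hX⟩
  · ext p q
    rw [hE]
    simp [-zsmul_eq_mul]
  · rw [EvenTrace, two_mul_trace_map, ZMod.intCast_zmod_eq_zero_iff_dvd] at hL
    obtain ⟨r, hr⟩ := hL
    exact ⟨r, by push_cast at hr; linarith⟩

theorem exists_reduction_eq_symElem {X : Sp g ℤ} (hX : X ∈ frakK g) :
    ∃ L, EvenTrace L ∧ reduction g 4 X = symElem L := by
  obtain ⟨L, E, hXL, r, hr⟩ := (inK_iff X).1 hX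
  have h4 : (4 : ZMod 4) = 0 := rfl
  refine ⟨L.map (Int.castRingHom (ZMod 4)), ?_, Subtype.ext ?_⟩
  · rw [EvenTrace, two_mul_trace_map, hr]
    push_cast
    linear_combination (r : ZMod 4) * h4
  · ext p q
    rw [coe_symElem_map, coe_reduction, hXL]
    simp [-zsmul_eq_mul, h4]

theorem ker_reduction_four_le : (reduction g 4).ker ≤ frakK g := by
  intro X hX
  have h : ∀ p q, ∃ e : ℤ, X.1 p q = (1 : Matrix (Fin g ⊕ Fin g) (Fin g ⊕ Fin g) ℤ) p q + 4 * e := by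
    intro p q
    obtain ⟨e, he⟩ := mem_cong_iff.1 hX p q
    exact ⟨e, by push_cast at he; linarith⟩
  choose E hE using h
  refine (inK_iff X).2 ⟨0, of E, ?_, by simp⟩
  ext p q
  rw [hE]
  simp

/-- The kernel of `q` is the image of `𝔎` modulo `4`, hence exactly the elements `symElem L` with
`EvenTrace L`. -/
theorem ker_le_commutator (hg : 3 ≤ g) {q : Sp g (ZMod 4) →* frakH g}
    (hq : q.comp (reduction g 4) = QuotientGroup.mk' (frakK g)) :
    q.ker ≤ ⁅q.ker, (⊤ : Subgroup (Sp g (ZMod 4)))⁆ := by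
  have hmem : ∀ X, reduction g 4 X ∈ q.ker ↔ X ∈ frakK g := fun X => by
    rw [MonoidHom.mem_ker, ← MonoidHom.comp_apply, hq, ← MonoidHom.mem_ker, QuotientGroup.ker_mk']
  intro Y hY
  obtain ⟨X, rfl⟩ := reduction_surjective (g := g) (N := 2 ^ 2) Y
  obtain ⟨L, hL, h⟩ := exists_reduction_eq_symElem ((hmem X).1 hY)
  have := symElem_mem_commutator (K := q.ker) hg (fun M hM => by
    obtain ⟨X, hX, h⟩ := exists_mem_frakK_reduction_eq hM
    rw [← h]
    exact (hmem X).2 hX) hL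
  rw [← h] at this
  exact this

end Sp

theorem mainTheorem7 (g : ℕ) (hg : 3 ≤ g) (A : Type u) [AddCommGroup A] :
    (∀ n : ℕ, 1 ≤ n → Function.Injective (trivialH2Map (Sp.reduction g (2 ^ n)) A)) ∧
    (∃! q : Sp g (ZMod 4) →* Sp.frakH g,
      q.comp (Sp.reduction g 4) = QuotientGroup.mk' (Sp.frakK g)) ∧
    (∀ q : Sp g (ZMod 4) →* Sp.frakH g,
      q.comp (Sp.reduction g 4) = QuotientGroup.mk' (Sp.frakK g) →
        Function.Injective (trivialH2Map q A)) := by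
  have h4 : Function.Surjective (Sp.reduction g 4) :=
    Sp.reduction_surjective (g := g) (N := 2 ^ 2)
  refine ⟨fun n hn => ?_, ⟨?_, ?_, ?_⟩, fun q hq => ?_⟩
  · have : NeZero n := ⟨by omega⟩
    exact trivialH2Map_injective _ Sp.reduction_surjective (Sp.cong_le_commutator hg hn) A
  · exact (Sp.reduction g 4).liftOfSurjective h4
      ⟨QuotientGroup.mk' (Sp.frakK g), by
        rw [QuotientGroup.ker_mk']; exact Sp.ker_reduction_four_le⟩
  · exact MonoidHom.liftOfRightInverse_comp (Sp.reduction g 4) _ (Function.rightInverse_surjInv h4)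
      ⟨QuotientGroup.mk' (Sp.frakK g), _⟩
  · intro q hq
    rw [← MonoidHom.cancel_right h4, hq]
    exact (MonoidHom.liftOfRightInverse_comp (Sp.reduction g 4) _ (Function.rightInverse_surjInv h4)
      ⟨QuotientGroup.mk' (Sp.frakK g), _⟩).symm
  · refine trivialH2Map_injective q (fun y => ?_) (Sp.ker_le_commutator hg hq) A
    obtain ⟨X, hX⟩ := QuotientGroup.mk'_surjective (Sp.frakK g) y
    exact ⟨Sp.reduction g 4 X, by rw [← hX, ← hq]; rfl⟩
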